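/- Let $d\ge 1$ and view $\mathbb Z^d$ as a graph with $x\sim y$ iff $|x-y|=1$, where $|x|=\sum_i|x_i|$. For a finite connected $\Lambda\subset\mathbb Z^d$ containing $0$, positive weights $\beta=(\beta_e)$ on the edges of $\mathbb Z^d$ and $\eta>0$, let $\mu_\Lambda^{\eta\delta_0,\beta}$ be the measure on $\mathbb R^\Lambda$ $$ d\mu_\Lambda^{\eta\delta_0,\beta}(t)=\Big(\prod_{j\in\Lambda}\frac{dt_j}{\sqrt{2\pi}}\Big)\, e^{-\sum_{k\in\Lambda}t_k}\, e^{-\sum_{\{i,j\}\subset\Lambda,\,i\sim j}\beta_{ij}(\cosh(t_i-t_j)-1)}\, e^{-\eta(\cosh t_0-1)}\,\sqrt{\det A(t)}, $$ where $A(t)$ is the $\Lambda\times\Lambda$ matrix with $A_{ij}=-\beta_{ij}e^{t_i+t_j}$ if $i\sim j$, $A_{ii}=\sum_{l\in\Lambda,\,l\sim i}\beta_{il}e^{t_i+t_l}+\eta\,e^{t_0}\mathbf 1_{\{i=0\}}$, and $A_{ij}=0$ otherwise. Write $\mu_\Lambda^{\eta\delta_0,\beta}(f)=\int f\,d\mu_\Lambda^{\eta\delta_0,\beta}$,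 and put $$ I_\eta=\sqrt{\eta}\int_{-\infty}^{\infty}e^{-\eta(\cosh t-1)}\frac{dt}{\sqrt{2\pi}} . $$ **Proposition.** For every $d\ge1$ there exist $a_c^d>0$ and $\delta\in(0,1)$ such that for every $0<a<a_c^d$ there is a constant $C_0>0$, depending only on $a$ and $d$, with the following property. If the weights $(\beta_e)$ are i.i.d. with law $\mathrm{Gamma}(a,1)$ and $\mathbb E$ denotes the expectation with respect to them, then for every $\eta>0$, every finite connected $\Lambda\subset\mathbb Z^d$ containing $0$, and all $x,y\in\Lambda$ with $x\sim y$, $$ \mathbb E\big(\mu_\Lambda^{\eta\delta_0,\beta}(e^{t_x/2})\big)\le C_0I_\eta\,\delta^{|x|}, \qquad \mathbb E\big(\beta_{xy}^{1/4}\,\mu_\Lambda^{\eta\delta_0,\beta}(e^{t_x/2})\big)\le C_0I_\eta\,\delta^{|x|}. $$ -/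

import Mathlib

open MeasureTheory ProbabilityTheory
open scoped ENNReal

noncomputable section

namespace SigmaModel

/-- The `ℓ¹` norm `|x|` of a point of `ℤ^d`. -/
def l1norm {d : ℕ} (x : Fin d → ℤ) : ℕ := ∑ i, (x i).natAbs

/-- The lattice `ℤ^d` as a graph: `x ∼ y` iff `|x - y| = 1`. -/
def lattice (d : ℕ) : SimpleGraph (Fin d → ℤ) where
  Adj x y := l1norm (x - y) = 1
  symm := ⟨fun x y h => by
    have e : l1norm (y - x) = l1norm (x - y) := by
      unfold l1norm
      refine Finset.sum_congr rfl fun i _ => ?_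
      rw [← Int.natAbs_neg]
      congr 1
      simp
    rw [e]
    exact h⟩
  loopless := ⟨fun x h => by simp [l1norm] at h⟩

/-- The undirected nearest-neighbour edges of `ℤ^d`. -/
abbrev Edge (d : ℕ) : Type := (lattice d).edgeSet

variable {d : ℕ}

open Classical in
/-- The symmetric function `(i, j) ↦ β_{ij}` attached to a family of edge weights: the weight of the
edge `{i, j}` if `i ∼ j`, and `0` otherwise. -/
def weight (β : Edge d → ℝ) (i j : Fin d → ℤ) : ℝ :=
  if h : (lattice d).Adj i j then β ⟨s(i, j), h⟩ else 0

/-- `F_Λ^β(∇t) = ∑_{{i,j} ∈ E_Λ} β_{ij} (cosh (t_i - t_j) - 1)`. The sum over unordered edges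
is written as half of the sum over ordered pairs. -/
def gradEnergy (Λ : Finset (Fin d → ℤ)) (β : Edge d → ℝ) (t : Λ → ℝ) : ℝ :=
  (1 / 2) * ∑ i : Λ, ∑ j : Λ, weight β i j * (Real.cosh (t i - t j) - 1)

/-- `M_Λ^ε(t) = ∑_{i ∈ Λ} ε_i (cosh t_i - 1)`. -/
def pinEnergy (Λ : Finset (Fin d → ℤ)) (ε : (Fin d → ℤ) → ℝ) (t : Λ → ℝ) : ℝ :=
  ∑ i : Λ, ε i * (Real.cosh (t i) - 1)

open Classical in
/-- The matrix `A_Λ^{ε,β}`: off-diagonal entries `-β_{ij} e^{t_i + t_j}` for `i ∼ j` (and `0`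
otherwise), diagonal entries `∑_{l ∼ i, l ∈ Λ} β_{il} e^{t_i + t_l} + ε_i e^{t_i}`. -/
def matA (Λ : Finset (Fin d → ℤ)) (ε : (Fin d → ℤ) → ℝ) (β : Edge d → ℝ) (t : Λ → ℝ) :
    Matrix Λ Λ ℝ :=
  Matrix.of fun i j =>
    if i = j then
      (∑ l : Λ, weight β i l * Real.exp (t i + t l)) + ε i * Real.exp (t i)
    else -(weight β i j * Real.exp (t i + t j))

open Classical in
/-- The density of `μ_Λ^{ε,β}` with respect to Lebesgue measure on `ℝ^Λ`. -/
def density (Λ : Finset (Fin d → ℤ)) (ε : (Fin d → ℤ) → ℝ) (β : Edge d → ℝ) (t : Λ → ℝ) : ℝ :=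
  (∏ _j : Λ, (Real.sqrt (2 * Real.pi))⁻¹) * Real.exp (-∑ k : Λ, t k) *
    Real.exp (-gradEnergy Λ β t) * Real.exp (-pinEnergy Λ ε t) *
    Real.sqrt (matA Λ ε β t).det

/-- The measure `μ_Λ^{ε,β}` on `ℝ^Λ`. -/
def mu (Λ : Finset (Fin d → ℤ)) (ε : (Fin d → ℤ) → ℝ) (β : Edge d → ℝ) : Measure (Λ → ℝ) :=
  volume.withDensity fun t => ENNReal.ofReal (density Λ ε β t)

/-- `I_η = √η ∫ e^{-η (cosh t - 1)} dt / √(2π)`. -/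
def besselI (η : ℝ) : ℝ :=
  Real.sqrt η * ∫ t : ℝ, Real.exp (-(η * (Real.cosh t - 1))) / Real.sqrt (2 * Real.pi)

/-- `μ_Λ^{η δ_0,β}(e^{t_x / 2})`, as an element of `[0, ∞]`. -/
def expMoment (Λ : Finset (Fin d → ℤ)) (η : ℝ) (β : Edge d → ℝ) (x : Λ) : ℝ≥0∞ :=
  ∫⁻ t, ENNReal.ofReal (Real.exp (t x / 2)) ∂(mu Λ (Pi.single 0 η) β)

end SigmaModel

end

/-! The factor `√det A` is the only nonlocal part of the density, and it is expanded over
self-avoiding paths. All column sums of `A` vanish except that of the origin, which equals `η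
e^{t_0}`, so `det A` is `η e^{t_0}` times the cofactor at `(0, x)`, for whichever `x` is convenient
(`det_eq_colSum_mul_adjugate`). Expanding that cofactor one row at a time
(`adjugate_rowRestrict_insert`) gives a sum over self-avoiding paths from `0` to `x`, and
subadditivity of the square root carries the sum outside it.

The factor `e^{t_x/2}` is exactly what makes each step `y → z` cost `√β_{yz} e^{-β_{yz}(cosh(t_y -
t_z) - 1)} / √(2π)` (`pathDensity_le_sum`). Once the path has reached `x`, the vertices off it form
a sigma model in the boundary field of the path, whose mass is at most one
(`lintegral_boundary_le_one`). That bound comes from the substitution `t ↦ h` with `(diag h - W) e^t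
= ε`, which turns the density into a multivariate inverse Gaussian; the latter is integrated one
coordinate at a time by Schur complements. Integrating along the path then bounds the moment by
`I_η` times a sum over paths of products of `I_{β_e}` (`lmarginal_pathDensity_le`,
`expMoment_le_pathSum`).

A self-avoiding path uses distinct, hence independent, edges. The mean of `I_b` under `Gamma(a, 1)`
is `O(Γ(a + 1/2) / Γ(a))`, which tends to `0` with `a` (`exists_lintegral_stepIntegral_le`). For
small `a` this beats the number of choices per step, and the expectation decays like `2^{-|x|}`
(`lintegral_pathSum_le`). -/

noncomputable section

namespace SigmaModel

/-! ### Cofactors of row restrictions -/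

section RowRestrict

variable {V : Type*} [Fintype V] [DecidableEq V]
set_option linter.unusedSectionVars false

/-- The matrix whose rows in `S` are those of `A` and whose other rows are those of the identity. -/
def rowRestrict (A : Matrix V V ℝ) (S : Finset V) : Matrix V V ℝ :=
  Matrix.of fun i j => if i ∈ S then A i j else (1 : Matrix V V ℝ) i j

lemma rowRestrict_univ (A : Matrix V V ℝ) : rowRestrict A Finset.univ = A := by
  ext i j; simp [rowRestrict]

lemma updateRow_rowRestrict_single (A : Matrix V V ℝ) {S : Finset V} {y : V} (hy : y ∉ S) :
    (rowRestrict A (insert y S)).updateRow y (Pi.single y 1) = rowRestrict A S := by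
  ext i j
  by_cases h : i = y
  · subst h
    simp [rowRestrict, hy, Matrix.one_apply, Pi.single_apply, eq_comm]
  · simp [rowRestrict, h]

lemma adjugate_rowRestrict_self (A : Matrix V V ℝ) {S : Finset V} {y : V} (hy : y ∉ S) :
    (rowRestrict A (insert y S)).adjugate y y = (rowRestrict A S).det := by
  rw [Matrix.adjugate_apply, updateRow_rowRestrict_single A hy]

lemma det_updateRow_eq_sum (M : Matrix V V ℝ) (y : V) (b : V → ℝ) :
    (M.updateRow y b).det = ∑ z, b z * (M.updateRow y (Pi.single z 1)).det := by
  rw [← Matrix.cramer_transpose_apply, Matrix.cramer_eq_adjugate_mulVec]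
  simp only [Matrix.mulVec, dotProduct, ← Matrix.adjugate_apply, ← Matrix.adjugate_transpose,
    Matrix.transpose_apply]
  exact Finset.sum_congr rfl fun z _ => mul_comm _ _

/-- Row `z` is already a unit vector, so placing the same unit vector in row `x` creates two equal
rows. -/
lemma adjugate_rowRestrict_of_notMem (A : Matrix V V ℝ) {S : Finset V} {x z : V} (hx : x ∈ S)
    (hz : z ∉ S) : (rowRestrict A S).adjugate z x = 0 := by
  rw [Matrix.adjugate_apply]
  have hzx : z ≠ x := fun h => hz (h ▸ hx)
  refine Matrix.det_zero_of_row_eq hzx ?_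
  ext j
  simp [Matrix.updateRow_apply, hzx, rowRestrict, hz, Matrix.one_apply, Pi.single_apply, eq_comm]

/-- Expansion of a cofactor along the first step of a path from `y` to `x`. -/
lemma adjugate_rowRestrict_insert (A : Matrix V V ℝ) {S : Finset V} {x y : V} (hy : y ∉ S)
    (hx : x ∈ S) :
    (rowRestrict A (insert y S)).adjugate y x =
      ∑ z ∈ S, -A y z * (rowRestrict A S).adjugate z x := by
  have hyx : y ≠ x := fun h => hy (h ▸ hx)
  have e1 : (rowRestrict A (insert y S)).updateRow x (Pi.single y 1) =
      ((rowRestrict A S).updateRow x (Pi.single y 1)).updateRow y (A y) := by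
    ext i j
    by_cases h : i = y
    · subst h; simp [rowRestrict, hyx]
    · by_cases h' : i = x
      · subst h'; simp [h]
      · simp [rowRestrict, h, h']
  rw [Matrix.adjugate_apply, e1, det_updateRow_eq_sum]
  have e2 : ∀ z, (((rowRestrict A S).updateRow x (Pi.single y 1)).updateRow y
      (Pi.single z 1)).det = -(rowRestrict A S).adjugate z x := by
    intro z
    -- Row `x` is `e_y` and row `y` is `e_z`. Swapping them restores the identity row at `y ∉ S`, at
    -- the price of a sign.
    have h : ((rowRestrict A S).updateRow x (Pi.single y 1)).updateRow y (Pi.single z 1) =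
        ((rowRestrict A S).updateRow x (Pi.single z 1)).submatrix (Equiv.swap x y) id := by
      ext i j
      by_cases h : i = y
      · subst h; simp
      · by_cases h' : i = x
        · subst h'; simp [h, hyx, rowRestrict, hy, Matrix.one_apply, Pi.single_apply, eq_comm]
        · simp [h, h', Equiv.swap_apply_of_ne_of_ne h' h]
    rw [Matrix.adjugate_apply, h, Matrix.det_permute, Equiv.Perm.sign_swap hyx.symm]
    simp
  simp only [e2]
  rw [← Finset.sum_subset (Finset.subset_univ S)]
  · exact Finset.sum_congr rfl fun z _ => by ring
  · intro z _ hz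
    rw [adjugate_rowRestrict_of_notMem A hx hz]; simp

/-- The rows outside `S` are identity rows, so the matrix is block triangular with an identity
block. -/
lemma det_rowRestrict (A : Matrix V V ℝ) (S : Finset V) :
    (rowRestrict A S).det = (A.submatrix ((↑) : S → V) ((↑) : S → V)).det := by
  rw [Matrix.twoBlockTriangular_det _ (· ∈ S)]
  · have : (rowRestrict A S).toSquareBlockProp (fun i => ¬ i ∈ S) = 1 := by
      ext i j
      simp [rowRestrict, Matrix.toSquareBlockProp, i.2, Matrix.one_apply, Subtype.ext_iff]
    rw [this, Matrix.det_one, mul_one]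
    have : (rowRestrict A S).toSquareBlockProp (fun i => i ∈ S) =
        A.submatrix ((↑) : S → V) ((↑) : S → V) := by
      ext i j
      simp [rowRestrict, Matrix.toSquareBlockProp]
    rw [this]
    congr!
  · intro i hi j hj
    have : i ≠ j := fun h => hi (h ▸ hj)
    simp [rowRestrict, hi, this]

/-- If all column sums of `A` but that of `o` vanish, the cofactors in row `o` are all equal. -/
lemma det_eq_colSum_mul_adjugate (A : Matrix V V ℝ) (o x : V) (p : ℝ)
    (h : ∀ j, ∑ i, A i j = if j = o then p else 0) : A.det = p * A.adjugate o x := by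
  -- Multiply `A · adj A = det A · 1` on the left by the all-ones row vector.
  have h1 := congrFun (congrArg (fun M => Matrix.vecMul (fun _ => (1 : ℝ)) M) (A.mul_adjugate)) x
  rw [← Matrix.vecMul_vecMul] at h1
  have h2 : Matrix.vecMul (fun _ => (1 : ℝ)) A = Pi.single o p := by
    ext j
    simp [Matrix.vecMul, dotProduct, h, Pi.single_apply]
  rw [h2] at h1
  simp only [Matrix.vecMul, dotProduct, Pi.single_apply, ite_mul, zero_mul, Finset.sum_ite_eq',
    Finset.mem_univ, if_true, Matrix.smul_apply, Matrix.one_apply, smul_eq_mul, one_mul,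
    mul_ite, mul_one, mul_zero] at h1
  rw [h1]

end RowRestrict

/-! ### One-dimensional integrals -/

lemma lintegral_rpow_mul_exp {b r : ℝ} (hb : 0 < b) (hr : 0 < r) :
    ∫⁻ x in Set.Ioi (0 : ℝ), ENNReal.ofReal (x ^ (b - 1) * Real.exp (-(r * x))) =
      ENNReal.ofReal (Real.Gamma b / r ^ b) := by
  have hG := Real.Gamma_pos_of_pos hb
  have hc : 0 < r ^ b / Real.Gamma b := div_pos (Real.rpow_pos_of_pos hr b) hG
  have h := lintegral_gammaPDF_eq_one hb hr
  have h1 : ∫⁻ x, gammaPDF b r x = ENNReal.ofReal (r ^ b / Real.Gamma b) *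
      ∫⁻ x in Set.Ioi (0 : ℝ), ENNReal.ofReal (x ^ (b - 1) * Real.exp (-(r * x))) := by
    rw [← lintegral_const_mul _ (by fun_prop), ← setLIntegral_univ, ← Set.Iio_union_Ici (a := (0:ℝ)),
      lintegral_union measurableSet_Ici (by
        rw [Set.disjoint_left]; intro x hx hx'; exact absurd (Set.mem_Ici.1 hx') (not_le.2 hx))]
    rw [setLIntegral_congr (Ioi_ae_eq_Ici (a := (0:ℝ))).symm]
    rw [setLIntegral_congr_fun (g := fun _ => 0) measurableSet_Iio
      (fun x hx => gammaPDF_of_neg hx)]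
    simp only [lintegral_const, zero_mul, zero_add]
    refine setLIntegral_congr_fun measurableSet_Ioi fun x hx => ?_
    rw [gammaPDF_of_nonneg (le_of_lt hx), ← ENNReal.ofReal_mul hc.le]
    congr 1; ring
  rw [h1] at h
  have h2 : Real.Gamma b / r ^ b = (r ^ b / Real.Gamma b)⁻¹ := by rw [inv_div]
  rw [h2, ENNReal.ofReal_inv_of_pos hc]
  exact ENNReal.eq_inv_of_mul_eq_one_left (by rw [mul_comm]; exact h)

lemma lintegral_exp_neg_sq_div_two :
    ∫⁻ x : ℝ, ENNReal.ofReal (Real.exp (-(x ^ 2 / 2))) = ENNReal.ofReal (Real.sqrt (2 * Real.pi)) := by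
  have h := integral_gaussian (1 / 2)
  rw [← ofReal_integral_eq_lintegral_ofReal]
  · congr 1
    rw [show 2 * Real.pi = Real.pi / (1 / 2) by ring, ← h]
    congr 1; ext x; congr 1; ring
  · have := integrable_exp_neg_mul_sq (b := 1 / 2) (by norm_num)
    refine this.congr (ae_of_all _ fun x => ?_)
    simp only; congr 1; ring
  · exact ae_of_all _ fun x => (Real.exp_pos _).le

/-- Since `cosh t = 1 + 2 sinh² (t/2)`, the substitution `x = 2√p sinh (t/2)` turns the integrand
into a Gaussian. -/
lemma lintegral_cosh_half {p : ℝ} (hp : 0 < p) :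
    ∫⁻ t : ℝ, ENNReal.ofReal (Real.sqrt p * Real.cosh (t / 2) * Real.exp (-(p * Real.cosh t))) ≤
      ENNReal.ofReal (Real.sqrt (2 * Real.pi) * Real.exp (-p)) := by
  have hsp := Real.sqrt_pos.2 hp
  have hinj : Set.InjOn (fun t : ℝ => 2 * Real.sqrt p * Real.sinh (t / 2)) Set.univ := by
    intro s _ t _ h
    have := Real.sinh_injective (mul_left_cancel₀ (by positivity) h)
    linarith
  have h := lintegral_image_eq_lintegral_abs_deriv_mul (s := Set.univ)
    (f := fun t : ℝ => 2 * Real.sqrt p * Real.sinh (t / 2))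
    (f' := fun t => Real.sqrt p * Real.cosh (t / 2)) MeasurableSet.univ
    (fun t _ => by
      have := (((hasDerivAt_id t).div_const 2).sinh).const_mul (2 * Real.sqrt p)
      refine (this.congr_deriv ?_).hasDerivWithinAt
      simp; ring) hinj
    (fun x => ENNReal.ofReal (Real.exp (-p) * Real.exp (-(x ^ 2 / 2))))
  rw [setLIntegral_univ] at h
  calc _ = ∫⁻ t : ℝ, ENNReal.ofReal |Real.sqrt p * Real.cosh (t / 2)| *
        ENNReal.ofReal (Real.exp (-p) *
          Real.exp (-((2 * Real.sqrt p * Real.sinh (t / 2)) ^ 2 / 2))) := by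
        refine lintegral_congr fun t => ?_
        have hc := Real.cosh_pos (t / 2)
        rw [abs_of_nonneg (by positivity), ← ENNReal.ofReal_mul (by positivity), ← Real.exp_add]
        congr 3
        have h1 : Real.cosh t = 1 + 2 * Real.sinh (t / 2) ^ 2 := by
          have := Real.cosh_two_mul (t / 2)
          rw [show 2 * (t / 2) = t by ring, Real.cosh_sq] at this
          linarith
        rw [h1, mul_pow, mul_pow, Real.sq_sqrt hp.le]; ring
    _ ≤ ∫⁻ x : ℝ, ENNReal.ofReal (Real.exp (-p) * Real.exp (-(x ^ 2 / 2))) := by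
        rw [← h]; exact setLIntegral_le_lintegral _ _
    _ = _ := by
        simp only [ENNReal.ofReal_mul (Real.exp_pos _).le]
        rw [lintegral_const_mul _ (by fun_prop), lintegral_exp_neg_sq_div_two,
          ← ENNReal.ofReal_mul (Real.exp_pos _).le, mul_comm]

/-- The other factors are even in `t`, so `e^{t/2}` may be replaced by its even part `cosh (t/2)`.
-/
lemma lintegral_exp_half {p : ℝ} (hp : 0 < p) :
    ∫⁻ t : ℝ, ENNReal.ofReal (Real.sqrt p * Real.exp (t / 2) * Real.exp (-(p * Real.cosh t))) ≤
      ENNReal.ofReal (Real.sqrt (2 * Real.pi) * Real.exp (-p)) := by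
  refine le_trans (le_of_eq ?_) (lintegral_cosh_half hp)
  have hneg : ∫⁻ t : ℝ, ENNReal.ofReal
        (Real.sqrt p * Real.exp (t / 2) * Real.exp (-(p * Real.cosh t))) =
      ∫⁻ t : ℝ, ENNReal.ofReal
        (Real.sqrt p * Real.exp (-(t / 2)) * Real.exp (-(p * Real.cosh t))) := by
    rw [← lintegral_neg_eq_self]
    refine lintegral_congr fun t => ?_
    rw [Real.cosh_neg, neg_div]
  have hsum : 2 * ∫⁻ t : ℝ, ENNReal.ofReal
        (Real.sqrt p * Real.exp (t / 2) * Real.exp (-(p * Real.cosh t))) =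
      2 * ∫⁻ t : ℝ, ENNReal.ofReal
        (Real.sqrt p * Real.cosh (t / 2) * Real.exp (-(p * Real.cosh t))) := by
    rw [two_mul]
    nth_rewrite 2 [hneg]
    rw [← lintegral_add_left (by fun_prop), ← lintegral_const_mul _ (by
      have := Real.continuous_cosh; fun_prop)]
    refine lintegral_congr fun t => ?_
    rw [← ENNReal.ofReal_add (by positivity) (by positivity), show (2 : ℝ≥0∞) = ENNReal.ofReal 2 by simp,
      ← ENNReal.ofReal_mul (by norm_num), Real.cosh_eq (t / 2)]
    congr 1; ring
  exact (ENNReal.mul_right_inj (by simp) (by simp)).1 hsum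

/-- Total mass of the unnormalised inverse Gaussian density. -/
lemma lintegral_inverseGaussian_of_nonneg {p : ℝ} (hp : 0 ≤ p) :
    ∫⁻ s in Set.Ioi (0 : ℝ), ENNReal.ofReal
        ((Real.sqrt s)⁻¹ * Real.exp (-(s / 2) - p ^ 2 / s / 2)) ≤
      ENNReal.ofReal (Real.sqrt (2 * Real.pi) * Real.exp (-p)) := by
  rcases hp.eq_or_lt with rfl | hp
  -- At `p = 0` the substitution used below degenerates; the integral is then `Γ(1/2)` up to
  -- scaling.
  · have h := lintegral_rpow_mul_exp (b := 1 / 2) (r := 1 / 2) (by norm_num) (by norm_num)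
    refine le_of_eq (Eq.trans ?_ (h.trans ?_))
    · refine setLIntegral_congr_fun measurableSet_Ioi fun s hs => ?_
      congr 2
      · rw [Real.sqrt_eq_rpow, ← Real.rpow_neg (le_of_lt hs)]; norm_num
      · congr 1; ring
    · congr 1
      rw [Real.Gamma_one_half_eq, ← Real.sqrt_eq_rpow, ← Real.sqrt_div Real.pi_pos.le]
      rw [neg_zero, Real.exp_zero, mul_one]; congr 1; ring
  -- Substituting `s = p e^t` gives `s/2 + p²/(2s) = p cosh t`.
  · have himg : (fun t : ℝ => p * Real.exp t) '' Set.univ = Set.Ioi 0 := by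
      ext s; constructor
      · rintro ⟨t, -, rfl⟩; exact mul_pos hp (Real.exp_pos _)
      · intro hs
        exact ⟨Real.log (s / p), trivial, by
          simp only; rw [Real.exp_log (div_pos hs hp)]; field_simp⟩
    rw [← himg, lintegral_image_eq_lintegral_abs_deriv_mul MeasurableSet.univ
      (f' := fun t : ℝ => p * Real.exp t)
      (fun t _ => ((Real.hasDerivAt_exp t).const_mul p).hasDerivWithinAt)
      (fun s _ t _ h => Real.exp_injective (mul_left_cancel₀ hp.ne' h)), setLIntegral_univ]
    refine le_trans (le_of_eq (lintegral_congr fun t => ?_)) (lintegral_exp_half hp)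
    have he := Real.exp_pos t
    rw [abs_of_pos (by positivity), ← ENNReal.ofReal_mul (by positivity)]
    congr 1
    rw [← mul_assoc]
    congr 1
    · have h1 : Real.sqrt (p * Real.exp t) = Real.sqrt p * Real.exp (t / 2) := by
        rw [Real.sqrt_mul hp.le, Real.exp_half]
      rw [← div_eq_mul_inv, Real.div_sqrt, h1]
    · congr 1
      rw [Real.cosh_eq, Real.exp_neg]; field_simp; ring

/-- The integrand depends only on `p²`, and `e^{-|p|} ≤ e^{-p}`. This frees the induction below from
sign conditions on `W` and `f`. -/
lemma lintegral_inverseGaussian (p : ℝ) :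
    ∫⁻ s in Set.Ioi (0 : ℝ), ENNReal.ofReal
        ((Real.sqrt s)⁻¹ * Real.exp (-(s / 2) - p ^ 2 / s / 2)) ≤
      ENNReal.ofReal (Real.sqrt (2 * Real.pi) * Real.exp (-p)) := by
  have h := lintegral_inverseGaussian_of_nonneg (abs_nonneg p)
  simp only [sq_abs] at h
  refine h.trans (ENNReal.ofReal_le_ofReal ?_)
  gcongr
  exact le_abs_self p

/-! ### The multivariate inverse Gaussian integral -/

open Matrix in
lemma schur_det {n : ℕ} (M : Matrix (Fin (n + 1)) (Fin (n + 1)) ℝ) (hM : M.IsSymm)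
    (hB : (M.submatrix Fin.succ Fin.succ).det ≠ 0) :
    M.det = (M 0 0 - (fun i => M i.succ 0) ⬝ᵥ
      (M.submatrix Fin.succ Fin.succ)⁻¹ *ᵥ (fun i => M i.succ 0)) *
        (M.submatrix Fin.succ Fin.succ).det := by
  set B := M.submatrix Fin.succ Fin.succ with hBdef
  set u : Fin n → ℝ := fun i => M i.succ 0 with hu
  let e : Fin n ⊕ Unit ≃ Fin (n + 1) :=
    (Equiv.optionEquivSumPUnit (Fin n)).symm.trans (finSuccEquiv n).symm
  have : Invertible B := Matrix.invertibleOfIsUnitDet B (isUnit_iff_ne_zero.2 hB)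
  have h : M.submatrix e e = Matrix.fromBlocks B (Matrix.replicateCol Unit u)
      (Matrix.replicateRow Unit u) (Matrix.of fun _ _ => M 0 0) := by
    ext i j
    rcases i with i | i <;> rcases j with j | j <;> simp [e, hBdef, hu]
    exact hM.apply _ _
  rw [← Matrix.det_submatrix_equiv_self e, h, Matrix.det_fromBlocks₁₁,
    Matrix.det_unique (n := Unit), mul_comm, Matrix.invOf_eq_nonsing_inv]
  congr 1
  simp [Matrix.mul_apply, dotProduct, Matrix.mulVec, Finset.sum_mul, Finset.mul_sum]
  rw [Finset.sum_comm]
  exact Finset.sum_congr rfl fun i _ => Finset.sum_congr rfl fun j _ => by ring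

open Matrix in
-- The Schur complement is the quotient of two positive determinants.
lemma schur_posDef {n : ℕ} {M : Matrix (Fin (n + 1)) (Fin (n + 1)) ℝ} (hM : M.PosDef) :
    0 < M 0 0 - (fun i => M i.succ 0) ⬝ᵥ
      (M.submatrix Fin.succ Fin.succ)⁻¹ *ᵥ (fun i => M i.succ 0) := by
  have hB : (M.submatrix Fin.succ Fin.succ).PosDef := hM.submatrix (Fin.succ_injective n)
  have h1 := schur_det M (by simpa using hM.isHermitian) hB.det_pos.ne'
  have h2 := hM.det_pos
  rw [h1] at h2
  exact (mul_pos_iff_of_pos_right hB.det_pos).1 h2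

open Matrix in
/-- The inverse quadratic form in terms of the Schur complement of the lower right block. -/
lemma schur_inv_quadForm {n : ℕ} {M : Matrix (Fin (n + 1)) (Fin (n + 1)) ℝ} (hM : M.PosDef)
    (f : Fin (n + 1) → ℝ) (u : Fin n → ℝ) (hu : ∀ i, M i.succ 0 = -u i)
    (B : Matrix (Fin n) (Fin n) ℝ) (hBM : B = M.submatrix Fin.succ Fin.succ) :
    f ⬝ᵥ M⁻¹ *ᵥ f = (f ∘ Fin.succ) ⬝ᵥ B⁻¹ *ᵥ (f ∘ Fin.succ) +
      (f 0 + u ⬝ᵥ B⁻¹ *ᵥ (f ∘ Fin.succ)) ^ 2 / (M 0 0 - u ⬝ᵥ B⁻¹ *ᵥ u) := by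
  have hB : B.PosDef := by rw [hBM]; exact hM.submatrix (Fin.succ_injective n)
  have hs := schur_posDef hM
  have hu' : (fun i => M i.succ 0) = -u := funext hu
  rw [hu', ← hBM, mulVec_neg, neg_dotProduct, dotProduct_neg, neg_neg] at hs
  set s := M 0 0 - u ⬝ᵥ B⁻¹ *ᵥ u with hsdef
  set f' := f ∘ Fin.succ with hf'
  set p := f 0 + u ⬝ᵥ B⁻¹ *ᵥ f' with hp
  have hMsymm : M.IsSymm := by simpa using hM.isHermitian
  have hBsymm : B.IsSymm := by simpa using hB.isHermitian
  have hBu : IsUnit B.det := isUnit_iff_ne_zero.2 hB.det_pos.ne'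
  have hMu : IsUnit M.det := isUnit_iff_ne_zero.2 hM.det_pos.ne'
  -- The solution of `M v = f` by block elimination, with first coordinate `p / s`.
  set v : Fin (n + 1) → ℝ := Fin.cons (p / s) (B⁻¹ *ᵥ f' + (p / s) • B⁻¹ *ᵥ u) with hv
  have hsw : f' ⬝ᵥ B⁻¹ *ᵥ u = u ⬝ᵥ B⁻¹ *ᵥ f' := by
    rw [dotProduct_mulVec, ← mulVec_transpose, transpose_nonsing_inv, hBsymm.eq, dotProduct_comm]
  have hMv : M *ᵥ v = f := by
    ext i
    refine Fin.cases ?_ (fun i => ?_) i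
    · have e1 : (M *ᵥ v) 0 = M 0 0 * (p / s) +
          (-u) ⬝ᵥ (B⁻¹ *ᵥ f' + (p / s) • B⁻¹ *ᵥ u) := by
        simp only [mulVec, dotProduct, Fin.sum_univ_succ, hv, Fin.cons_zero, Fin.cons_succ]
        congr 1
        refine Finset.sum_congr rfl fun j _ => ?_
        rw [← hMsymm.apply, hu]; rfl
      rw [e1, neg_dotProduct, dotProduct_add, dotProduct_smul, smul_eq_mul]
      have : M 0 0 = s + u ⬝ᵥ B⁻¹ *ᵥ u := by rw [hsdef]; ring
      rw [this]
      have : s * (p / s) = p := by field_simp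
      linear_combination this + hp
    · have e1 : (M *ᵥ v) i.succ = -u i * (p / s) +
          (B *ᵥ (B⁻¹ *ᵥ f' + (p / s) • B⁻¹ *ᵥ u)) i := by
        simp only [mulVec, dotProduct, Fin.sum_univ_succ, hv, Fin.cons_zero, Fin.cons_succ, hu, hBM,
          submatrix_apply]
      rw [e1, mulVec_add, mulVec_smul, mulVec_mulVec, mulVec_mulVec, mul_nonsing_inv _ hBu,
        one_mulVec, one_mulVec]
      simp [hf']; ring
  have hMf : M⁻¹ *ᵥ f = v := by
    rw [← hMv, mulVec_mulVec, nonsing_inv_mul _ hMu, one_mulVec]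
  rw [hMf]
  have e2 : f ⬝ᵥ v = f 0 * (p / s) + f' ⬝ᵥ (B⁻¹ *ᵥ f' + (p / s) • B⁻¹ *ᵥ u) := by
    simp only [dotProduct, Fin.sum_univ_succ, hv, Fin.cons_zero, Fin.cons_succ]
    rfl
  rw [e2, dotProduct_add, dotProduct_smul, smul_eq_mul, hsw]
  have : p ^ 2 / s = p * (p / s) := by ring
  rw [this]
  linear_combination (-(p / s)) * hp

open Matrix in
/-- The unnormalised density of the multivariate inverse Gaussian law in terms of
the matrix `H = diag h - W`. -/
def invGaussDensity {ι : Type*} [Fintype ι] [DecidableEq ι] (H : Matrix ι ι ℝ) (f : ι → ℝ) : ℝ :=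
  (Real.sqrt H.det)⁻¹ * Real.exp (-(1 / 2) * (∑ i, ∑ j, H i j) - (1 / 2) * (f ⬝ᵥ H⁻¹ *ᵥ f))

open Matrix in
-- One step of the recursion. Writing `M 0 0 = s + u·B⁻¹u` completes the square, so `B` carries the
-- shifted field `f' + u`. The cross term `u·B⁻¹f' = p - f 0` leaves a factor `e^p`, which the mass
-- `√(2π) e^{-p}` of the one-dimensional factor in `s` cancels.
lemma invGaussDensity_cons {n : ℕ} {M : Matrix (Fin (n + 1)) (Fin (n + 1)) ℝ} (hM : M.PosDef)
    (f : Fin (n + 1) → ℝ) (u : Fin n → ℝ) (hu : ∀ i, M i.succ 0 = -u i)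
    (B : Matrix (Fin n) (Fin n) ℝ) (hBM : B = M.submatrix Fin.succ Fin.succ) (s p : ℝ)
    (hs : s = M 0 0 - u ⬝ᵥ B⁻¹ *ᵥ u) (hp : p = f 0 + u ⬝ᵥ B⁻¹ *ᵥ (f ∘ Fin.succ)) :
    invGaussDensity M f = Real.exp (-f 0 + ∑ i, u i) * Real.exp p *
      invGaussDensity B (f ∘ Fin.succ + u) *
        ((Real.sqrt s)⁻¹ * Real.exp (-(s / 2) - p ^ 2 / s / 2)) := by
  have hB : B.PosDef := by rw [hBM]; exact hM.submatrix (Fin.succ_injective n)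
  have hBsymm : B.IsSymm := by simpa using hB.isHermitian
  have hMsymm : M.IsSymm := by simpa using hM.isHermitian
  have hu' : (fun i => M i.succ 0) = -u := funext hu
  have hsp := schur_posDef hM
  have hdet := schur_det M hMsymm (by rw [← hBM]; exact hB.det_pos.ne')
  rw [hu', ← hBM, mulVec_neg, neg_dotProduct, dotProduct_neg, neg_neg, ← hs] at hsp hdet
  have hq := schur_inv_quadForm hM f u hu B hBM
  rw [← hs, ← hp] at hq
  have hsw : (f ∘ Fin.succ) ⬝ᵥ B⁻¹ *ᵥ u = u ⬝ᵥ B⁻¹ *ᵥ (f ∘ Fin.succ) := by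
    rw [dotProduct_mulVec, ← mulVec_transpose, transpose_nonsing_inv, hBsymm.eq, dotProduct_comm]
  have hsum : ∑ i, ∑ j, M i j = M 0 0 - 2 * ∑ i, u i + ∑ i, ∑ j, B i j := by
    simp only [Fin.sum_univ_succ, hu, Finset.sum_add_distrib, hBM, submatrix_apply,
      Finset.sum_neg_distrib]
    have : ∀ j : Fin n, M 0 j.succ = -u j := fun j => by rw [← hMsymm.apply, hu]
    simp only [this, Finset.sum_neg_distrib]; ring
  unfold invGaussDensity
  rw [hdet, hq, hsum, Real.sqrt_mul hsp.le, mul_inv, add_dotProduct, mulVec_add, dotProduct_add,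
    dotProduct_add, hsw]
  have e : ∀ a b e1 e2 e3 e4 E : ℝ, E = e1 + e2 + e3 + e4 →
      a * b * Real.exp E = Real.exp e1 * Real.exp e2 * (b * Real.exp e3) * (a * Real.exp e4) := by
    intro a b e1 e2 e3 e4 E h
    rw [h, Real.exp_add, Real.exp_add, Real.exp_add]; ring
  apply e
  have h00 : M 0 0 = s + u ⬝ᵥ B⁻¹ *ᵥ u := by rw [hs]; ring
  rw [h00]
  linear_combination (-1 : ℝ) * hp

open Matrix in
-- Positive definiteness is positive semidefiniteness, a closed condition, together with `det ≠ 0`,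
-- an open one.
lemma measurableSet_posDef {ι : Type*} [Fintype ι] [DecidableEq ι] (W : Matrix ι ι ℝ)
    (hW : W.IsSymm) : MeasurableSet {h : ι → ℝ | (diagonal h - W).PosDef} := by
  have hH : ∀ h : ι → ℝ, (diagonal h - W).IsHermitian := fun h => by
    rw [Matrix.IsHermitian, conjTranspose_eq_transpose_of_trivial, transpose_sub,
      diagonal_transpose, hW.eq]
  have hc : Continuous fun h : ι → ℝ => diagonal h - W := by fun_prop
  have e : {h : ι → ℝ | (diagonal h - W).PosDef} =
      (⋂ x : ι → ℝ, {h | 0 ≤ star x ⬝ᵥ (diagonal h - W) *ᵥ x}) ∩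
        {h | (diagonal h - W).det ≠ 0} := by
    ext h
    simp only [Set.mem_ofPred_eq, Set.mem_inter_iff, Set.mem_iInter]
    constructor
    · intro hp
      exact ⟨fun x => hp.posSemidef.dotProduct_mulVec_nonneg x, hp.det_pos.ne'⟩
    · rintro ⟨h1, h2⟩
      exact (PosSemidef.of_dotProduct_mulVec_nonneg (hH h) h1).posDef_iff_isUnit.2
        ((isUnit_iff_isUnit_det _).2 (isUnit_iff_ne_zero.2 h2))
  rw [e]
  refine MeasurableSet.inter (IsClosed.measurableSet ?_) (IsOpen.measurableSet ?_)
  · refine isClosed_iInter fun x => isClosed_le continuous_const ?_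
    exact continuous_const.dotProduct (hc.matrix_mulVec continuous_const)
  · exact isOpen_ne_fun hc.matrix_det continuous_const

open Matrix in
/-- Upper bound for the multivariate inverse Gaussian integral. -/
theorem lintegral_invGaussDensity_fin (n : ℕ) (W : Matrix (Fin n) (Fin n) ℝ) (hW : W.IsSymm)
    (f : Fin n → ℝ) :
    ∫⁻ h in {h : Fin n → ℝ | (diagonal h - W).PosDef},
        ENNReal.ofReal (invGaussDensity (diagonal h - W) f) ≤
      ENNReal.ofReal (Real.sqrt (2 * Real.pi) ^ n * Real.exp (-∑ i, f i)) := by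
  induction n with
  | zero =>
    refine (setLIntegral_le_lintegral _ _).trans ?_
    simp [invGaussDensity, volume_pi]
  | succ n ih =>
    set W' := W.submatrix Fin.succ Fin.succ with hW'
    set u : Fin n → ℝ := fun i => W i.succ 0 with hu
    set B : (Fin n → ℝ) → Matrix (Fin n) (Fin n) ℝ := fun h => diagonal h - W' with hB
    set c : (Fin n → ℝ) → ℝ := fun h => W 0 0 + u ⬝ᵥ (B h)⁻¹ *ᵥ u with hc
    set p : (Fin n → ℝ) → ℝ := fun h => f 0 + u ⬝ᵥ (B h)⁻¹ *ᵥ (f ∘ Fin.succ) with hp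
    let φ : ℝ → ℝ → ℝ≥0∞ := fun p s => (Set.Ioi 0).indicator (fun s => ENNReal.ofReal
      ((Real.sqrt s)⁻¹ * Real.exp (-(s / 2) - p ^ 2 / s / 2))) s
    let G : (Fin n → ℝ) → ℝ≥0∞ := {h | (B h).PosDef}.indicator fun h =>
      ENNReal.ofReal (Real.exp (-f 0 + ∑ i, u i) * Real.exp (p h) *
        invGaussDensity (B h) (f ∘ Fin.succ + u))
    have hD : ∀ (M : Matrix (Fin n) (Fin n) ℝ) g, 0 ≤ invGaussDensity M g := fun M g => by
      unfold invGaussDensity; positivity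
    have hmeas := measurableSet_posDef W hW
    -- For fixed remaining coordinates, the Schur complement is a translate of `h 0`, so no Jacobian
    -- appears.
    have hpt : ∀ h : Fin (n + 1) → ℝ, {h : Fin (n + 1) → ℝ | (diagonal h - W).PosDef}.indicator
        (fun h => ENNReal.ofReal (invGaussDensity (diagonal h - W) f)) h ≤
        G (Fin.tail h) * φ (p (Fin.tail h)) (h 0 - c (Fin.tail h)) := by
      intro h
      by_cases hM : (diagonal h - W).PosDef
      · have hBM : B (Fin.tail h) = (diagonal h - W).submatrix Fin.succ Fin.succ := by
          ext i j; simp [hB, hW', diagonal_apply, Fin.tail]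
        have hBp : (B (Fin.tail h)).PosDef := by
          rw [hBM]; exact hM.submatrix (Fin.succ_injective n)
        have hu2 : ∀ i : Fin n, (diagonal h - W) i.succ 0 = -u i := fun i => by
          simp [hu]
        have hs : h 0 - c (Fin.tail h) =
            (diagonal h - W) 0 0 - u ⬝ᵥ (B (Fin.tail h))⁻¹ *ᵥ u := by
          simp [hc]; ring
        have hspos : 0 < h 0 - c (Fin.tail h) := by
          have h1 := schur_posDef hM
          have hu' : (fun i : Fin n => (diagonal h - W) i.succ 0) = -u := funext hu2
          rw [hu', ← hBM, mulVec_neg, neg_dotProduct, dotProduct_neg, neg_neg, ← hs] at h1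
          exact h1
        rw [Set.indicator_of_mem (by exact hM), invGaussDensity_cons hM f u hu2 _ hBM _ _ hs rfl]
        simp only [G, φ]
        rw [Set.indicator_of_mem (by exact hBp), Set.indicator_of_mem (by exact hspos),
          ← ENNReal.ofReal_mul]
        exact mul_nonneg (by positivity) (hD _ _)
      · rw [Set.indicator_of_notMem (by exact hM)]; exact zero_le
    rw [← lintegral_indicator hmeas]
    refine (lintegral_mono hpt).trans ?_
    let Φ : ℝ × (Fin n → ℝ) → ℝ≥0∞ := fun z => G z.2 * φ (p z.2) (z.1 - c z.2)
    have e1 := (volume_preserving_piFinSuccAbove (fun _ : Fin (n + 1) => ℝ) 0).lintegral_comp_emb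
      (MeasurableEquiv.measurableEmbedding _) Φ
    have e2 := (Measure.measurePreserving_swap (μ := (volume : Measure (Fin n → ℝ)))
      (ν := (volume : Measure ℝ))).lintegral_comp_emb MeasurableEquiv.prodComm.measurableEmbedding Φ
    refine (le_of_eq e1).trans ((le_of_eq e2.symm).trans ?_)
    -- For an upper bound, the inequality half of Tonelli suffices; it asks for no measurability of
    -- `Φ`.
    refine (lintegral_prod_le _).trans ?_
    have hbound : ∀ h : Fin n → ℝ, ∫⁻ s : ℝ, Φ (s, h) ≤
        ENNReal.ofReal (Real.sqrt (2 * Real.pi) * Real.exp (-f 0 + ∑ i, u i)) *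
          {h | (B h).PosDef}.indicator
            (fun h => ENNReal.ofReal (invGaussDensity (B h) (f ∘ Fin.succ + u))) h := by
      intro h
      have hφ : ∀ q, ∫⁻ s, φ q s ≤ ENNReal.ofReal (Real.sqrt (2 * Real.pi) * Real.exp (-q)) :=
        fun q => by
          simp only [φ]
          rw [lintegral_indicator measurableSet_Ioi]
          exact lintegral_inverseGaussian q
      by_cases hp' : (B h).PosDef
      · have hG : G h ≠ ⊤ := by
          simp only [G]; rw [Set.indicator_of_mem (by exact hp')]; exact ENNReal.ofReal_ne_top
        simp only [Φ]
        rw [lintegral_const_mul' _ _ hG, lintegral_sub_right_eq_self (φ (p h)) (c h)]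
        refine (mul_le_mul_right (hφ _) _).trans ?_
        simp only [G]
        rw [Set.indicator_of_mem (by exact hp'), Set.indicator_of_mem (by exact hp'),
          ← ENNReal.ofReal_mul (by have := hD (B h) (f ∘ Fin.succ + u); positivity),
          ← ENNReal.ofReal_mul (by positivity)]
        refine ENNReal.ofReal_le_ofReal (le_of_eq ?_)
        have : Real.exp (p h) * Real.exp (-p h) = 1 := by rw [← Real.exp_add]; simp
        linear_combination (Real.exp (-f 0 + ∑ i, u i) * invGaussDensity (B h) (f ∘ Fin.succ + u) *
          Real.sqrt (2 * Real.pi)) * this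
      · have hG : G h = 0 := by
          simp only [G]; rw [Set.indicator_of_notMem (by exact hp')]
        simp [Φ, hG]
    refine (lintegral_mono hbound).trans ?_
    rw [lintegral_const_mul' _ _ ENNReal.ofReal_ne_top,
      lintegral_indicator (measurableSet_posDef W' (by rw [hW']; exact hW.submatrix _))]
    refine (mul_le_mul_right (ih W' (by rw [hW']; exact hW.submatrix _) _) _).trans ?_
    rw [← ENNReal.ofReal_mul (by positivity)]
    refine ENNReal.ofReal_le_ofReal (le_of_eq ?_)
    rw [mul_mul_mul_comm, ← Real.exp_add, pow_succ', Fin.sum_univ_succ]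
    congr 2
    simp only [Pi.add_apply, Function.comp_apply, Finset.sum_add_distrib]
    ring

/-! ### The sigma model in a boundary field has mass at most one: change of variables to the inverse
Gaussian law. -/

section Normalization

open Matrix

variable {ι : Type*} [Fintype ι] [DecidableEq ι]
set_option linter.unusedSectionVars false

lemma invGaussDensity_submatrix {κ : Type*} [Fintype κ] [DecidableEq κ] (H : Matrix ι ι ℝ)
    (f : ι → ℝ) (e : κ ≃ ι) :
    invGaussDensity (H.submatrix e e) (f ∘ e) = invGaussDensity H f := by
  unfold invGaussDensity
  rw [det_submatrix_equiv_self, inv_submatrix_equiv]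
  congr 3
  · congr 1
    simp only [submatrix_apply]
    rw [← e.sum_comp]
    exact Finset.sum_congr rfl fun i _ => e.sum_comp (fun j => H (e i) j)
  · congr 1
    rw [submatrix_mulVec_equiv, Function.comp_assoc, e.self_comp_symm, Function.comp_id]
    exact comp_equiv_dotProduct_comp_equiv _ _ e

/-- Upper bound for the multivariate inverse Gaussian integral. -/
theorem lintegral_invGaussDensity (W : Matrix ι ι ℝ) (hW : W.IsSymm) (f : ι → ℝ) :
    ∫⁻ h in {h : ι → ℝ | (diagonal h - W).PosDef},
        ENNReal.ofReal (invGaussDensity (diagonal h - W) f) ≤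
      ENNReal.ofReal (Real.sqrt (2 * Real.pi) ^ Fintype.card ι * Real.exp (-∑ i, f i)) := by
  let e : Fin (Fintype.card ι) ≃ ι := (Fintype.equivFin ι).symm
  have h1 := lintegral_invGaussDensity_fin _ (W.submatrix e e) (hW.submatrix _) (f ∘ e)
  rw [← lintegral_indicator (measurableSet_posDef _ (hW.submatrix _))] at h1
  rw [← lintegral_indicator (measurableSet_posDef _ hW),
    ← (volume_measurePreserving_piCongrLeft (fun _ : ι => ℝ) e).lintegral_comp_emb
      (MeasurableEquiv.measurableEmbedding _)]
  refine le_trans (le_of_eq (lintegral_congr fun a => ?_)) (h1.trans (le_of_eq ?_))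
  · set h := (MeasurableEquiv.piCongrLeft (fun _ : ι => ℝ) e) a with hh
    have ha : ∀ i, h (e i) = a i := fun i => by
      rw [hh, MeasurableEquiv.coe_piCongrLeft, Equiv.piCongrLeft_apply_apply]
    have hs : diagonal a - W.submatrix e e = (diagonal h - W).submatrix e e := by
      ext i j; simp [diagonal_apply, ha]
    classical
    simp only [Set.indicator_apply, Set.mem_ofPred_eq, hs, invGaussDensity_submatrix]
    have : ((diagonal h - W).submatrix e e).PosDef ↔ (diagonal h - W).PosDef := by
      refine ⟨fun hp => ?_, fun hp => hp.submatrix e.injective⟩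
      have := hp.submatrix e.symm.injective
      simpa using this
    simp only [this]
  · congr 3
    rw [neg_inj]
    exact e.sum_comp f

/-- An invertible positive definite matrix with nonpositive off-diagonal entries has a
nonnegative inverse. -/
lemma posDef_inv_nonneg {H : Matrix ι ι ℝ} (hH : H.PosDef) (hoff : ∀ i j, i ≠ j → H i j ≤ 0)
    (i j : ι) : 0 ≤ H⁻¹ i j := by
  have hu : IsUnit H.det := isUnit_iff_ne_zero.2 hH.det_pos.ne'
  set v : ι → ℝ := H⁻¹ *ᵥ Pi.single j 1 with hv
  have hHv : H *ᵥ v = Pi.single j 1 := by rw [hv, mulVec_mulVec, mul_nonsing_inv _ hu, one_mulVec]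
  have hvi : H⁻¹ i j = v i := by simp [hv]
  -- `w` is the negative part of a column of the inverse. It and the positive part `v + w` have
  -- disjoint supports, so `w·H(v + w) ≤ 0`, while `w·Hv = w j ≥ 0`. Hence `w·Hw ≤ 0`, which forces
  -- `w = 0`.
  set w : ι → ℝ := fun i => max (-v i) 0 with hw
  have hw0 : w = 0 := by
    by_contra hne
    have h1 := hH.dotProduct_mulVec_pos hne
    have h2 : 0 ≤ w ⬝ᵥ H *ᵥ v := by
      rw [hHv]; simp [hw]
    have h3 : w ⬝ᵥ H *ᵥ (v + w) ≤ 0 := by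
      simp only [dotProduct, mulVec, Finset.mul_sum]
      refine Finset.sum_nonpos fun a _ => Finset.sum_nonpos fun b _ => ?_
      have hwa : 0 ≤ w a := le_max_right _ _
      have hb : 0 ≤ (v + w) b := by
        simp only [Pi.add_apply, hw]; linarith [le_max_left (-v b) 0]
      by_cases hab : a = b
      · subst hab
        have : w a * (v + w) a = 0 := by
          simp only [Pi.add_apply, hw]
          rcases le_total (-v a) 0 with h | h
          · rw [max_eq_right h]; simp
          · rw [max_eq_left h]; simp
        have : w a * (H a a * (v + w) a) = 0 := by linear_combination H a a * this
        exact this.le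
      · have := mul_nonneg hwa (mul_nonneg (neg_nonneg.2 (hoff a b hab)) hb)
        linarith
    rw [mulVec_add, dotProduct_add] at h3
    simp only [star_trivial] at h1
    linarith
  have : w i = 0 := congrFun hw0 i
  rw [hvi]
  have h4 : -v i ≤ w i := le_max_left _ _
  linarith

/-- Symmetrise in `i, j` and apply the arithmetic-geometric mean inequality to `a i * ε j` and `a j
* ε i`. -/
lemma quadForm_sqrt_le {G : Matrix ι ι ℝ} (hG : ∀ i j, 0 ≤ G i j) (hs : G.IsSymm) {a ε : ι → ℝ}
    (ha : ∀ i, 0 ≤ a i) (hε : ∀ i, 0 ≤ ε i) :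
    (fun i => Real.sqrt (a i * ε i)) ⬝ᵥ G *ᵥ (fun i => Real.sqrt (a i * ε i)) ≤ a ⬝ᵥ G *ᵥ ε := by
  have h1 : a ⬝ᵥ G *ᵥ ε = ∑ i, ∑ j, G i j * ((a i * ε j + a j * ε i) / 2) := by
    have e1 : a ⬝ᵥ G *ᵥ ε = ∑ i, ∑ j, G i j * (a i * ε j) := by
      simp only [dotProduct, mulVec, Finset.mul_sum]
      exact Finset.sum_congr rfl fun i _ => Finset.sum_congr rfl fun j _ => by ring
    have e2 : a ⬝ᵥ G *ᵥ ε = ∑ i, ∑ j, G i j * (a j * ε i) := by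
      rw [e1, Finset.sum_comm]
      exact Finset.sum_congr rfl fun i _ => Finset.sum_congr rfl fun j _ => by rw [hs.apply]
    have e3 : a ⬝ᵥ G *ᵥ ε = (a ⬝ᵥ G *ᵥ ε + a ⬝ᵥ G *ᵥ ε) / 2 := by ring
    rw [e3]
    nth_rewrite 1 [e1]
    rw [e2, ← Finset.sum_add_distrib, Finset.sum_div]
    refine Finset.sum_congr rfl fun i _ => ?_
    rw [← Finset.sum_add_distrib, Finset.sum_div]
    exact Finset.sum_congr rfl fun j _ => by ring
  rw [h1]
  simp only [dotProduct, mulVec, Finset.mul_sum]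
  refine Finset.sum_le_sum fun i _ => Finset.sum_le_sum fun j _ => ?_
  have h2 : Real.sqrt (a i * ε i) * Real.sqrt (a j * ε j) ≤ (a i * ε j + a j * ε i) / 2 := by
    have e : Real.sqrt (a i * ε i) * Real.sqrt (a j * ε j) =
        Real.sqrt (a i * ε j) * Real.sqrt (a j * ε i) := by
      rw [← Real.sqrt_mul (mul_nonneg (ha i) (hε i)), ← Real.sqrt_mul (mul_nonneg (ha i) (hε j))]
      congr 1; ring
    rw [e]
    have s1 := Real.sq_sqrt (mul_nonneg (ha i) (hε j))
    have s2 := Real.sq_sqrt (mul_nonneg (ha j) (hε i))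
    nlinarith [sq_nonneg (Real.sqrt (a i * ε j) - Real.sqrt (a j * ε i))]
  nlinarith [mul_le_mul_of_nonneg_left h2 (hG i j)]

/-- The potential `h` for which `(diag h - W) e^t = ε`. -/
def potential (W : Matrix ι ι ℝ) (ε : ι → ℝ) (t : ι → ℝ) (i : ι) : ℝ :=
  ∑ l, W i l * Real.exp (t l - t i) + ε i * Real.exp (-t i)

lemma mulVec_exp_potential (W : Matrix ι ι ℝ) (ε t : ι → ℝ) :
    (diagonal (potential W ε t) - W) *ᵥ (fun i => Real.exp (t i)) = ε := by
  ext i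
  rw [sub_mulVec, Pi.sub_apply, mulVec_diagonal]
  simp only [potential, mulVec, dotProduct, add_mul, Finset.sum_mul]
  have h1 : ∀ l, W i l * Real.exp (t l - t i) * Real.exp (t i) = W i l * Real.exp (t l) := by
    intro l; rw [mul_assoc, ← Real.exp_add]; congr 2; ring
  have h2 : ε i * Real.exp (-t i) * Real.exp (t i) = ε i := by
    rw [mul_assoc, ← Real.exp_add]; simp
  simp only [h1, h2]; ring

/-- The quadratic form is a sum of squares: `ε_i e^{-t_i} v_i²` at each vertex, and one weighted
square for each pair. -/
lemma posSemidef_potential {W : Matrix ι ι ℝ} (hW : W.IsSymm) (hW0 : ∀ i j, 0 ≤ W i j)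
    {ε : ι → ℝ} (hε : ∀ i, 0 ≤ ε i) (t : ι → ℝ) :
    (diagonal (potential W ε t) - W).PosSemidef := by
  refine PosSemidef.of_dotProduct_mulVec_nonneg ?_ fun v => ?_
  · rw [Matrix.IsHermitian, conjTranspose_eq_transpose_of_trivial, transpose_sub,
      diagonal_transpose, hW.eq]
  · have e1 : star v ⬝ᵥ (diagonal (potential W ε t) - W) *ᵥ v =
        ∑ i, ε i * Real.exp (-t i) * v i ^ 2 +
          ∑ i, ∑ j, (W i j * Real.exp (t j - t i) * v i ^ 2 - W i j * (v i * v j)) := by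
      rw [← Finset.sum_add_distrib]
      simp only [dotProduct, star_trivial, sub_mulVec, Pi.sub_apply, mulVec_diagonal]
      refine Finset.sum_congr rfl fun i _ => ?_
      rw [Finset.sum_sub_distrib, ← Finset.sum_mul]
      simp only [potential, mulVec, dotProduct]
      rw [mul_sub, Finset.mul_sum, add_mul]
      have : ∀ j, v i * (W i j * v j) = W i j * (v i * v j) := fun j => by ring
      simp only [this]; ring
    have e2 : ∑ i, ∑ j, (W i j * Real.exp (t j - t i) * v i ^ 2 - W i j * (v i * v j)) =
        ∑ i, ∑ j, W i j / 2 *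
          (Real.exp ((t j - t i) / 2) * v i - Real.exp ((t i - t j) / 2) * v j) ^ 2 := by
      have sw : ∑ i, ∑ j, (W i j * Real.exp (t j - t i) * v i ^ 2 - W i j * (v i * v j)) =
          ∑ i, ∑ j, (W i j * Real.exp (t i - t j) * v j ^ 2 - W i j * (v i * v j)) := by
        rw [Finset.sum_comm]
        exact Finset.sum_congr rfl fun i _ => Finset.sum_congr rfl fun j _ => by
          rw [hW.apply]; ring
      have e3 : ∀ x : ℝ, x = (x + x) / 2 := fun x => by ring
      rw [e3 (∑ i, ∑ j, (W i j * Real.exp (t j - t i) * v i ^ 2 - W i j * (v i * v j)))]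
      nth_rewrite 2 [sw]
      rw [← Finset.sum_add_distrib, Finset.sum_div]
      refine Finset.sum_congr rfl fun i _ => ?_
      rw [← Finset.sum_add_distrib, Finset.sum_div]
      refine Finset.sum_congr rfl fun j _ => ?_
      have q1 : Real.exp (t j - t i) = Real.exp ((t j - t i) / 2) ^ 2 := by
        rw [← Real.exp_nat_mul]; congr 1; push_cast; ring
      have q2 : Real.exp (t i - t j) = Real.exp ((t i - t j) / 2) ^ 2 := by
        rw [← Real.exp_nat_mul]; congr 1; push_cast; ring
      have q3 : Real.exp ((t j - t i) / 2) * Real.exp ((t i - t j) / 2) = 1 := by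
        rw [← Real.exp_add, ← Real.exp_zero]; congr 1; ring
      rw [q1, q2]
      linear_combination (W i j * v i * v j) * q3
    rw [e1, e2]
    refine add_nonneg (Finset.sum_nonneg fun i _ => ?_)
      (Finset.sum_nonneg fun i _ => Finset.sum_nonneg fun j _ => ?_)
    · have := hε i; positivity
    · have := hW0 i j; positivity

/-- The derivative of `potential W ε`. -/
def potentialDeriv (W : Matrix ι ι ℝ) (ε t : ι → ℝ) : (ι → ℝ) →L[ℝ] (ι → ℝ) :=
  LinearMap.toContinuousLinearMap (Matrix.toLin' (-(diagonal (fun i => Real.exp (-t i)) *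
    (diagonal (potential W ε t) - W) * diagonal (fun i => Real.exp (t i)))))

/-- The derivative is minus the conjugate of `H = diag h - W` by `diag e^t`. The Jacobian `|det H|`
turns the `(√det H)⁻¹` of the inverse Gaussian density into the `√det H` of the sigma model. -/
lemma abs_det_potentialDeriv (W : Matrix ι ι ℝ) (ε t : ι → ℝ) :
    |(potentialDeriv W ε t).det| = |(diagonal (potential W ε t) - W).det| := by
  rw [potentialDeriv, ContinuousLinearMap.det, LinearMap.coe_toContinuousLinearMap,
    LinearMap.det_toLin', det_neg, abs_mul, abs_pow, abs_neg, abs_one, one_pow, one_mul, det_mul,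
    det_mul, det_diagonal, det_diagonal, mul_right_comm, ← Finset.prod_mul_distrib]
  simp [← Real.exp_add]

lemma hasFDerivAt_potential (W : Matrix ι ι ℝ) (ε t : ι → ℝ) :
    HasFDerivAt (potential W ε) (potentialDeriv W ε t) t := by
  rw [hasFDerivAt_pi']
  intro i
  have hp : ∀ l, HasFDerivAt (fun t : ι → ℝ => t l) (ContinuousLinearMap.proj (R := ℝ) l) t :=
    fun l => hasFDerivAt_apply l t
  have h : HasFDerivAt (fun s => potential W ε s i)
      (∑ l, W i l • Real.exp (t l - t i) • (ContinuousLinearMap.proj (R := ℝ) l -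
          ContinuousLinearMap.proj (R := ℝ) i) +
        ε i • Real.exp (-t i) • -ContinuousLinearMap.proj (R := ℝ) i) t :=
    (HasFDerivAt.fun_sum (u := Finset.univ) fun l _ => ((((hp l).sub (hp i)).exp).const_mul (W i l))).add
    (((hp i).neg.exp).const_mul (ε i))
  refine h.congr_fderiv ?_
  ext v
  have e1 : potentialDeriv W ε t v i =
      -(Real.exp (-t i) * (potential W ε t i * (Real.exp (t i) * v i) -
        ∑ l, W i l * (Real.exp (t l) * v l))) := by
    have : (diagonal fun i => Real.exp (t i)) *ᵥ v = fun l => Real.exp (t l) * v l := by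
      ext l; rw [mulVec_diagonal]
    rw [potentialDeriv, LinearMap.coe_toContinuousLinearMap', Matrix.toLin'_apply, neg_mulVec,
      Pi.neg_apply, ← mulVec_mulVec, ← mulVec_mulVec, mulVec_diagonal, this, sub_mulVec,
      Pi.sub_apply, mulVec_diagonal]
    rfl
  have e2 : Real.exp (-t i) * Real.exp (t i) = 1 := by rw [← Real.exp_add]; simp
  have e3 : ∀ l, Real.exp (t l - t i) = Real.exp (-t i) * Real.exp (t l) := fun l => by
    rw [← Real.exp_add]; congr 1; ring
  have e4 : ∑ l, W i l * Real.exp (t l - t i) * (v l - v i) =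
      Real.exp (-t i) * ∑ l, W i l * (Real.exp (t l) * v l) -
        (∑ l, W i l * Real.exp (t l - t i)) * v i := by
    rw [Finset.mul_sum, Finset.sum_mul, ← Finset.sum_sub_distrib]
    exact Finset.sum_congr rfl fun l _ => by rw [e3]; ring
  generalize ∑ l, W i l * (Real.exp (t l) * v l) = S at e1 e4
  rw [ContinuousLinearMap.comp_apply, ContinuousLinearMap.proj_apply, e1]
  simp only [_root_.add_apply, FunLike.coe_sum, Finset.sum_apply,
    _root_.smul_apply, _root_.sub_apply, _root_.neg_apply,
    ContinuousLinearMap.proj_apply, smul_eq_mul, ← mul_assoc]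
  rw [e4, potential]
  linear_combination (∑ l, W i l * Real.exp (t l - t i) + ε i * Real.exp (-t i)) * v i * e2

/-- Where `H` is invertible, `t` is recovered from `e^t = H⁻¹ ε`. -/
lemma injOn_potential (W : Matrix ι ι ℝ) (ε : ι → ℝ) :
    Set.InjOn (potential W ε) {t | (diagonal (potential W ε t) - W).det ≠ 0} := by
  intro s hs t _ hst
  have h1 := mulVec_exp_potential W ε s
  have h2 := mulVec_exp_potential W ε t
  rw [← hst] at h2
  have h3 := congrArg (fun v => (diagonal (potential W ε s) - W)⁻¹ *ᵥ v) (h1.trans h2.symm)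
  simp only [mulVec_mulVec, nonsing_inv_mul _ (isUnit_iff_ne_zero.2 hs), one_mulVec] at h3
  ext i
  exact Real.exp_injective (congrFun h3 i)

/-- The weighted Laplacian matrix with Dirichlet terms `ε`. -/
def dirichletMatrix (W : Matrix ι ι ℝ) (ε t : ι → ℝ) : Matrix ι ι ℝ :=
  Matrix.of fun i j => if i = j then ∑ l, W i l * Real.exp (t i + t l) + ε i * Real.exp (t i)
    else -(W i j * Real.exp (t i + t j))

lemma dirichletMatrix_eq {W : Matrix ι ι ℝ} (hd : ∀ i, W i i = 0) (ε t : ι → ℝ) :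
    dirichletMatrix W ε t = diagonal (fun i => Real.exp (t i)) *
      (diagonal (potential W ε t) - W) * diagonal (fun i => Real.exp (t i)) := by
  ext i j
  rw [mul_diagonal, diagonal_mul, Matrix.sub_apply, dirichletMatrix, of_apply, diagonal_apply]
  split_ifs with h
  · subst h
    rw [hd, sub_zero, potential, mul_add, add_mul, Finset.mul_sum, Finset.sum_mul]
    congr 1
    · refine Finset.sum_congr rfl fun l _ => ?_
      have : Real.exp (t i + t l) = Real.exp (t i) * Real.exp (t l - t i) * Real.exp (t i) := by
        rw [← Real.exp_add, ← Real.exp_add]; congr 1; ring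
      rw [this]; ring
    · have : Real.exp (t i) = Real.exp (t i) * Real.exp (-t i) * Real.exp (t i) := by
        rw [← Real.exp_add, ← Real.exp_add]; congr 1; ring
      nth_rewrite 1 [this]; ring
  · rw [Real.exp_add]; ring

/-- The factor `e^{∑ t}` produced here cancels the `e^{-∑ t}` of the density. -/
lemma sqrt_det_dirichletMatrix {W : Matrix ι ι ℝ} (hd : ∀ i, W i i = 0) (ε t : ι → ℝ) :
    Real.sqrt (dirichletMatrix W ε t).det =
      Real.exp (∑ i, t i) * Real.sqrt (diagonal (potential W ε t) - W).det := by
  rw [dirichletMatrix_eq hd, det_mul, det_mul, det_diagonal, mul_right_comm, ← sq,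
    Real.sqrt_mul (sq_nonneg _), Real.sqrt_sq (Finset.prod_nonneg fun i _ => (Real.exp_pos _).le),
    Real.exp_sum]

/-- The interaction energy on `ι` with a boundary field. -/
def boundaryEnergy (W : Matrix ι ι ℝ) (a ε m : ι → ℝ) (t : ι → ℝ) : ℝ :=
  (1 / 2) * ∑ i, ∑ j, W i j * (Real.cosh (t i - t j) - 1) +
    ∑ i, (a i * Real.exp (t i) / 2 + ε i * Real.exp (-t i) / 2 - m i)

/-- With `e^t = H⁻¹ ε` the energy becomes a function of `H` alone, as the change of variables
requires. -/
lemma boundaryEnergy_eq {W : Matrix ι ι ℝ} (hW : W.IsSymm) (a ε m t : ι → ℝ) :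
    boundaryEnergy W a ε m t =
      (1 / 2) * (∑ i, ∑ j, (diagonal (potential W ε t) - W) i j) +
        (1 / 2) * (a ⬝ᵥ fun i => Real.exp (t i)) - ∑ i, m i := by
  have h1 : ∑ i, ∑ j, W i j * (Real.cosh (t i - t j) - 1) =
      ∑ i, ∑ j, W i j * Real.exp (t j - t i) - ∑ i, ∑ j, W i j := by
    have sw : ∑ i, ∑ j, W i j * Real.exp (t i - t j) = ∑ i, ∑ j, W i j * Real.exp (t j - t i) := by
      rw [Finset.sum_comm]
      exact Finset.sum_congr rfl fun i _ => Finset.sum_congr rfl fun j _ => by rw [hW.apply]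
    have e : ∑ i, ∑ j, W i j * (Real.cosh (t i - t j) - 1) =
        (∑ i, ∑ j, W i j * Real.exp (t i - t j) + ∑ i, ∑ j, W i j * Real.exp (t j - t i)) / 2 -
          ∑ i, ∑ j, W i j := by
      simp only [← Finset.sum_add_distrib, Finset.sum_div, ← Finset.sum_sub_distrib]
      refine Finset.sum_congr rfl fun i _ => Finset.sum_congr rfl fun j _ => ?_
      rw [Real.cosh_eq, neg_sub]; ring
    rw [e, sw]; ring
  have h2 : ∑ i, ∑ j, (diagonal (potential W ε t) - W) i j =
      ∑ i, ∑ j, W i j * Real.exp (t j - t i) + ∑ i, ε i * Real.exp (-t i) -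
        ∑ i, ∑ j, W i j := by
    simp only [Matrix.sub_apply, Finset.sum_sub_distrib, diagonal_apply, Finset.sum_ite_eq,
      Finset.mem_univ, if_true, potential, Finset.sum_add_distrib]
  rw [boundaryEnergy, h1, h2]
  simp only [Finset.sum_add_distrib, Finset.sum_sub_distrib, dotProduct, ← Finset.sum_div]
  ring

/-- The partition function with a boundary field is at most one. -/
theorem lintegral_boundary_le_one {W : Matrix ι ι ℝ} (hW : W.IsSymm) (hW0 : ∀ i j, 0 ≤ W i j)
    (hd : ∀ i, W i i = 0) {a ε m : ι → ℝ} (ha : ∀ i, 0 ≤ a i) (hε : ∀ i, 0 ≤ ε i)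
    (hm : ∀ i, m i ≤ Real.sqrt (a i * ε i)) :
    ∫⁻ t : ι → ℝ, ENNReal.ofReal ((Real.sqrt (2 * Real.pi))⁻¹ ^ Fintype.card ι *
      Real.exp (-∑ i, t i) * Real.exp (-boundaryEnergy W a ε m t) *
        Real.sqrt (dirichletMatrix W ε t).det) ≤ 1 := by
  set c := (Real.sqrt (2 * Real.pi))⁻¹ ^ Fintype.card ι with hc
  have hc0 : 0 ≤ c := by positivity
  set f : ι → ℝ := fun i => Real.sqrt (a i * ε i) with hf
  set g : (ι → ℝ) → ℝ≥0∞ := fun h =>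
    ENNReal.ofReal (c * Real.exp (∑ i, m i) * invGaussDensity (diagonal h - W) f) with hg
  -- Outside `U` the determinant factor annihilates the density.
  set U : Set (ι → ℝ) := {t | (diagonal (potential W ε t) - W).det ≠ 0} with hU
  have hcont : Continuous (potential W ε) := by
    refine continuous_pi fun i => ?_
    unfold potential; fun_prop
  have hUo : IsOpen U := isOpen_ne_fun
    (((hcont.matrix_diagonal).sub continuous_const).matrix_det) continuous_const
  have hpd : ∀ t ∈ U, (diagonal (potential W ε t) - W).PosDef := fun t ht =>
    (posSemidef_potential hW hW0 hε t).posDef_iff_isUnit.2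
      ((isUnit_iff_isUnit_det _).2 (isUnit_iff_ne_zero.2 ht))
  have hpt : ∀ t, ENNReal.ofReal (c * Real.exp (-∑ i, t i) *
      Real.exp (-boundaryEnergy W a ε m t) * Real.sqrt (dirichletMatrix W ε t).det) ≤
      U.indicator (fun t => ENNReal.ofReal |(potentialDeriv W ε t).det| *
        g (potential W ε t)) t := by
    intro t
    rw [sqrt_det_dirichletMatrix hd]
    by_cases ht : t ∈ U
    · rw [Set.indicator_of_mem ht, hg, ← ENNReal.ofReal_mul (abs_nonneg _),
        abs_det_potentialDeriv]
      refine ENNReal.ofReal_le_ofReal ?_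
      have hp := hpd t ht
      set H := diagonal (potential W ε t) - W with hH
      have hdet := hp.det_pos
      have hsq := Real.sqrt_pos.2 hdet
      have hsymm : H.IsSymm := by simpa using hp.isHermitian
      have hexp : (fun i => Real.exp (t i)) = H⁻¹ *ᵥ ε := by
        have := mulVec_exp_potential W ε t
        rw [← this, mulVec_mulVec, nonsing_inv_mul _ (isUnit_iff_ne_zero.2 ht), one_mulVec]
      -- The energy contains `a·H⁻¹ε`, while the inverse Gaussian needs a form `f·H⁻¹f`. Taking `f =
      -- √(a ε)` only enlarges the density, and its mass `e^{-∑ f}` then absorbs `e^{∑ m}`.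
      have hq : f ⬝ᵥ H⁻¹ *ᵥ f ≤ a ⬝ᵥ H⁻¹ *ᵥ ε := by
        refine quadForm_sqrt_le (posDef_inv_nonneg hp fun i j hij => ?_) ?_ ha hε
        · rw [hH, Matrix.sub_apply, diagonal_apply_ne _ hij]
          simpa using hW0 i j
        · rw [Matrix.IsSymm, transpose_nonsing_inv, hsymm.eq]
      rw [boundaryEnergy_eq hW, ← hH, hexp, abs_of_pos hdet, invGaussDensity]
      have hs : H.det * (Real.sqrt H.det)⁻¹ = Real.sqrt H.det := by
        rw [← div_eq_mul_inv, Real.div_sqrt]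
      have e1 : c * Real.exp (-∑ i, t i) * Real.exp (-((1 / 2) * (∑ i, ∑ j, H i j) +
          (1 / 2) * (a ⬝ᵥ H⁻¹ *ᵥ ε) - ∑ i, m i)) *
          (Real.exp (∑ i, t i) * Real.sqrt H.det) =
          c * Real.sqrt H.det * Real.exp (∑ i, m i) *
            Real.exp (-(1 / 2) * (∑ i, ∑ j, H i j) - (1 / 2) * (a ⬝ᵥ H⁻¹ *ᵥ ε)) := by
        have q : Real.exp (-∑ i, t i) * Real.exp (∑ i, t i) = 1 := by
          rw [← Real.exp_add]; simp
        have q2 : Real.exp (-((1 / 2) * (∑ i, ∑ j, H i j) +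
          (1 / 2) * (a ⬝ᵥ H⁻¹ *ᵥ ε) - ∑ i, m i)) = Real.exp (∑ i, m i) *
            Real.exp (-(1 / 2) * (∑ i, ∑ j, H i j) - (1 / 2) * (a ⬝ᵥ H⁻¹ *ᵥ ε)) := by
          rw [← Real.exp_add]; congr 1; ring
        rw [q2]
        linear_combination (c * (Real.exp (∑ i, m i) *
            Real.exp (-(1 / 2) * (∑ i, ∑ j, H i j) - (1 / 2) * (a ⬝ᵥ H⁻¹ *ᵥ ε))) *
            Real.sqrt H.det) * q
      rw [e1]
      calc _ ≤ c * Real.sqrt H.det * Real.exp (∑ i, m i) *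
            Real.exp (-(1 / 2) * (∑ i, ∑ j, H i j) - (1 / 2) * (f ⬝ᵥ H⁻¹ *ᵥ f)) := by gcongr
        _ = _ := by
          nth_rewrite 1 [← hs]; ring
    · have h0 : (diagonal (potential W ε t) - W).det = 0 := by simpa [hU] using ht
      simp [h0]
  refine (lintegral_mono hpt).trans ?_
  rw [lintegral_indicator hUo.measurableSet,
    ← lintegral_image_eq_lintegral_abs_det_fderiv_mul volume hUo.measurableSet
      (fun t _ => (hasFDerivAt_potential W ε t).hasFDerivWithinAt) (injOn_potential W ε) g]
  have hsub : potential W ε '' U ⊆ {h | (diagonal h - W).PosDef} := by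
    rintro _ ⟨t, ht, rfl⟩; exact hpd t ht
  refine (lintegral_mono_set hsub).trans ?_
  simp only [hg]
  have hcm : 0 ≤ c * Real.exp (∑ i, m i) := by positivity
  simp only [ENNReal.ofReal_mul hcm]
  rw [lintegral_const_mul' _ _ ENNReal.ofReal_ne_top]
  refine (mul_le_mul_right (lintegral_invGaussDensity W hW f) _).trans ?_
  rw [← ENNReal.ofReal_mul hcm, ENNReal.ofReal_le_one]
  have hpi : c * Real.sqrt (2 * Real.pi) ^ Fintype.card ι = 1 := by
    rw [hc, ← mul_pow, inv_mul_cancel₀ (by positivity), one_pow]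
  have hexp : Real.exp (∑ i, m i) * Real.exp (-∑ i, f i) ≤ 1 := by
    rw [← Real.exp_add, Real.exp_le_one_iff]
    have := Finset.sum_le_sum fun i (_ : i ∈ Finset.univ) => hm i
    simp only [hf]; linarith
  calc _ = c * Real.sqrt (2 * Real.pi) ^ Fintype.card ι *
        (Real.exp (∑ i, m i) * Real.exp (-∑ i, f i)) := by ring
    _ ≤ 1 := by rw [hpi, one_mul]; exact hexp

end Normalization

/-! ### Expansion of the integral over self-avoiding paths. -/

section PathExpansion

variable {V : Type*} [Fintype V] [DecidableEq V]
set_option linter.unusedSectionVars false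

/-- The interaction energy of the edges meeting `S`. -/
def touchEnergy (W : Matrix V V ℝ) (S : Finset V) (t : V → ℝ) : ℝ :=
  (1 / 2) * ∑ i ∈ S, ∑ j ∈ S, W i j * (Real.cosh (t i - t j) - 1) +
    ∑ i ∈ S, ∑ j ∈ Sᶜ, W i j * (Real.cosh (t i - t j) - 1)

lemma touchEnergy_insert {W : Matrix V V ℝ} (hW : W.IsSymm) {S : Finset V} {z : V} (hz : z ∉ S)
    (t : V → ℝ) : touchEnergy W (insert z S) t =
      touchEnergy W S t + ∑ k ∈ (insert z S)ᶜ, W z k * (Real.cosh (t z - t k) - 1) := by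
  have hc : Sᶜ = insert z (insert z S)ᶜ := by
    ext k; by_cases h : k = z <;> simp [h, hz]
  have hz' : z ∉ (insert z S)ᶜ := by simp
  have hs : ∀ i, W i z * (Real.cosh (t i - t z) - 1) = W z i * (Real.cosh (t z - t i) - 1) := by
    intro i; rw [hW.apply, ← Real.cosh_neg, neg_sub]
  unfold touchEnergy
  rw [hc]
  simp only [Finset.sum_insert hz, Finset.sum_insert hz', Finset.sum_add_distrib, hs, sub_self,
    Real.cosh_zero, mul_zero, zero_add]
  ring

/-- Of the edges from `z` to the complement of `S`, only the one crossed by the path is kept; the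
others have nonnegative energy. -/
lemma touchEnergy_erase_add_le {W : Matrix V V ℝ} (hW : W.IsSymm) (hW0 : ∀ i j, 0 ≤ W i j)
    {S : Finset V} {y z : V} (hy : y ∉ S) (hz : z ∈ S) (t : V → ℝ) :
    touchEnergy W (S.erase z) t + W y z * (Real.cosh (t y - t z) - 1) ≤ touchEnergy W S t := by
  have h := touchEnergy_insert hW (Finset.notMem_erase z S) t
  rw [Finset.insert_erase hz] at h
  rw [h]
  have hs : W y z * (Real.cosh (t y - t z) - 1) = W z y * (Real.cosh (t z - t y) - 1) := by
    rw [hW.apply, ← Real.cosh_neg, neg_sub]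
  rw [hs]
  gcongr
  exact Finset.single_le_sum (f := fun k => W z k * (Real.cosh (t z - t k) - 1))
    (fun k _ => mul_nonneg (hW0 _ _) (sub_nonneg.2 (Real.one_le_cosh _))) (by simpa using hy)

/-- The weight of one step of a path across an edge of weight `w` with increment `s`. -/
def stepWeight (w s : ℝ) : ℝ :=
  (Real.sqrt (2 * Real.pi))⁻¹ * (Real.sqrt w * Real.exp (-(w * (Real.cosh s - 1))))

lemma stepWeight_nonneg (w s : ℝ) : 0 ≤ stepWeight w s := by unfold stepWeight; positivity

lemma continuous_stepWeight : Continuous fun z : ℝ × ℝ => stepWeight z.1 z.2 := by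
  have := Real.continuous_cosh
  unfold stepWeight; fun_prop

/-- The integral `I_w = √w ∫ e^{-w (cosh s - 1)} ds / √(2π)`, as an element of `[0, ∞]`. -/
def stepIntegral (w : ℝ) : ℝ≥0∞ := ∫⁻ s, ENNReal.ofReal (stepWeight w s)

/-- The sum over self-avoiding paths from `y` to `x` with at most `n` steps, all of them in `S`,
of the product of the step weights. -/
def pathSum (J : V → V → ℝ≥0∞) (x : V) : ℕ → Finset V → V → ℝ≥0∞
  | 0, _, y => if y = x then 1 else 0
  | n + 1, S, y => if y = x then 1 else ∑ z ∈ S, J y z * pathSum J x n (S.erase z) z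

lemma pathSum_self (J : V → V → ℝ≥0∞) (x : V) (n : ℕ) (S : Finset V) : pathSum J x n S x = 1 := by
  cases n <;> simp [pathSum]

/-- The integrand attached to the paths from `y` to `x` through `S`. -/
def pathDensity (W : Matrix V V ℝ) (ε : V → ℝ) (x : V) (S : Finset V) (y : V) (t : V → ℝ) : ℝ :=
  (Real.sqrt (2 * Real.pi))⁻¹ ^ S.card * Real.exp (-∑ i ∈ S, t i) *
    Real.exp (-touchEnergy W S t) * Real.exp ((t x - t y) / 2) *
      Real.sqrt ((rowRestrict (dirichletMatrix W ε t) (insert y S)).adjugate y x)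

lemma pathDensity_nonneg (W : Matrix V V ℝ) (ε : V → ℝ) (x : V) (S : Finset V) (y : V)
    (t : V → ℝ) : 0 ≤ pathDensity W ε x S y t := by
  unfold pathDensity; positivity

lemma continuous_dirichletMatrix (W : Matrix V V ℝ) (ε : V → ℝ) :
    Continuous (dirichletMatrix W ε) := by
  refine continuous_matrix fun i j => ?_
  simp only [dirichletMatrix, Matrix.of_apply]
  split_ifs <;> fun_prop

lemma continuous_pathDensity (W : Matrix V V ℝ) (ε : V → ℝ) (x : V) (S : Finset V) (y : V) :
    Continuous (pathDensity W ε x S y) := by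
  have h1 : Continuous (touchEnergy W S) := by
    have := Real.continuous_cosh
    unfold touchEnergy; fun_prop
  have h2 : Continuous fun t => (rowRestrict (dirichletMatrix W ε t) (insert y S)).adjugate y x := by
    refine Continuous.matrix_elem (Continuous.matrix_adjugate (continuous_matrix fun i j => ?_)) y x
    simp only [rowRestrict, Matrix.of_apply]
    split_ifs
    · exact (continuous_dirichletMatrix W ε).matrix_elem i j
    · exact continuous_const
  have h3 : Continuous fun t : V → ℝ => Real.exp (-∑ i ∈ S, t i) := by fun_prop
  have h4 : Continuous fun t : V → ℝ => Real.exp ((t x - t y) / 2) := by fun_prop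
  exact (((continuous_const.mul h3).mul (Real.continuous_exp.comp h1.neg)).mul h4).mul
    (Real.continuous_sqrt.comp h2)

lemma measurable_pathDensity (W : Matrix V V ℝ) (ε : V → ℝ) (x : V) (S : Finset V) (y : V) :
    Measurable fun t => ENNReal.ofReal (pathDensity W ε x S y t) :=
  (continuous_pathDensity W ε x S y).measurable.ennreal_ofReal

/-- Since `Real.sqrt` is `0` on negative numbers no sign is needed, and positivity of the cofactors
never has to be proved. -/
lemma sqrt_sum_le_sum_sqrt {ι : Type*} (s : Finset ι) (f : ι → ℝ) :
    Real.sqrt (∑ i ∈ s, f i) ≤ ∑ i ∈ s, Real.sqrt (f i) := by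
  classical
  induction s using Finset.induction_on with
  | empty => simp
  | insert i s hi ih =>
    rw [Finset.sum_insert hi, Finset.sum_insert hi]
    refine le_trans ?_ (add_le_add le_rfl ih)
    rcases le_total 0 (f i) with h | h <;> rcases le_total 0 (∑ i ∈ s, f i) with h' | h'
    · refine Real.sqrt_le_iff.2 ⟨by positivity, ?_⟩
      have := Real.sqrt_nonneg (f i)
      have := Real.sqrt_nonneg (∑ i ∈ s, f i)
      nlinarith [Real.sq_sqrt h, Real.sq_sqrt h', mul_nonneg (Real.sqrt_nonneg (f i)) this]
    · exact (Real.sqrt_le_sqrt (add_le_of_nonpos_right h')).trans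
        (le_add_of_nonneg_right (Real.sqrt_nonneg _))
    · exact (Real.sqrt_le_sqrt (add_le_of_nonpos_left h)).trans
        (le_add_of_nonneg_left (Real.sqrt_nonneg _))
    · rw [Real.sqrt_eq_zero_of_nonpos (by linarith)]; positivity

/-- One step of the path. The entry `W y z * e^{t_y + t_z}` contributes `√(W y z)` and `e^{(t_y +
t_z)/2}`; the latter, with `e^{-t_z}`, turns `e^{(t_x - t_y)/2}` into `e^{(t_x - t_z)/2}`, so the
integrand keeps its shape. -/
lemma pathDensity_le_sum {W : Matrix V V ℝ} (hW : W.IsSymm) (hW0 : ∀ i j, 0 ≤ W i j) (ε : V → ℝ)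
    {x y : V} {S : Finset V} (hy : y ∉ S) (hx : x ∈ S) (t : V → ℝ) :
    pathDensity W ε x S y t ≤
      ∑ z ∈ S, stepWeight (W y z) (t y - t z) * pathDensity W ε x (S.erase z) z t := by
  rw [pathDensity, adjugate_rowRestrict_insert _ hy hx]
  refine (mul_le_mul_of_nonneg_left (sqrt_sum_le_sum_sqrt _ _) (by positivity)).trans ?_
  rw [Finset.mul_sum]
  refine Finset.sum_le_sum fun z hz => ?_
  have hyz : y ≠ z := fun h => hy (h ▸ hz)
  have hA : -dirichletMatrix W ε t y z = W y z * Real.exp (t y + t z) := by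
    simp [dirichletMatrix, hyz]
  have hwz := hW0 y z
  rw [hA, Real.sqrt_mul (x := W y z * Real.exp (t y + t z)) (by positivity), Real.sqrt_mul hwz,
    ← Real.exp_half]
  rw [pathDensity, stepWeight, Finset.insert_erase hz]
  set N := Real.sqrt ((rowRestrict (dirichletMatrix W ε t) S).adjugate z x)
  have hN : 0 ≤ N := Real.sqrt_nonneg _
  have hcard : S.card = (S.erase z).card + 1 := (Finset.card_erase_add_one hz).symm
  have hsum : ∑ i ∈ S, t i = t z + ∑ i ∈ S.erase z, t i := (Finset.add_sum_erase S t hz).symm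
  have hE : Real.exp (-touchEnergy W S t) ≤ Real.exp (-touchEnergy W (S.erase z) t) *
      Real.exp (-(W y z * (Real.cosh (t y - t z) - 1))) := by
    rw [← Real.exp_add]
    exact Real.exp_le_exp.2 (by linarith [touchEnergy_erase_add_le hW hW0 hy hz t])
  have hexp : Real.exp (-(t z + ∑ i ∈ S.erase z, t i)) * Real.exp ((t x - t y) / 2) *
      Real.exp ((t y + t z) / 2) = Real.exp (-∑ i ∈ S.erase z, t i) *
        Real.exp ((t x - t z) / 2) := by
    rw [← Real.exp_add, ← Real.exp_add, ← Real.exp_add]; congr 1; ring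
  rw [hcard, hsum, pow_succ]
  set c := (Real.sqrt (2 * Real.pi))⁻¹
  have hc : 0 ≤ c := by positivity
  calc _ = c ^ (S.erase z).card * c * (Real.exp (-(t z + ∑ i ∈ S.erase z, t i)) *
        Real.exp ((t x - t y) / 2) * Real.exp ((t y + t z) / 2)) *
          Real.exp (-touchEnergy W S t) * (Real.sqrt (W y z) * N) := by ring
    _ ≤ c ^ (S.erase z).card * c * (Real.exp (-(t z + ∑ i ∈ S.erase z, t i)) *
        Real.exp ((t x - t y) / 2) * Real.exp ((t y + t z) / 2)) *
          (Real.exp (-touchEnergy W (S.erase z) t) *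
            Real.exp (-(W y z * (Real.cosh (t y - t z) - 1)))) * (Real.sqrt (W y z) * N) := by
        gcongr
    _ = _ := by rw [hexp]; ring

/-- The outer vertices of `S` act on the field in `S` as a boundary field. -/
lemma lmarginal_pathDensity_self {W : Matrix V V ℝ} (hW : W.IsSymm) (hW0 : ∀ i j, 0 ≤ W i j)
    (hd : ∀ i, W i i = 0) {ε : V → ℝ} {x : V} {S : Finset V} (hε : ∀ i ∈ S, ε i = 0)
    (hx : x ∉ S) (t : V → ℝ) :
    (∫⋯∫⁻_S, (fun t => ENNReal.ofReal (pathDensity W ε x S x t)) ∂fun _ => volume) t ≤ 1 := by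
  -- Cauchy-Schwarz: this is the condition `m ≤ √(a ε)` for the field created by the vertices
  -- outside `S`.
  have hcs : ∀ i : S, ∑ k ∈ Sᶜ, W i k ≤ Real.sqrt ((∑ k ∈ Sᶜ, W i k * Real.exp (-t k)) *
      ∑ k ∈ Sᶜ, W i k * Real.exp (t k)) := by
    intro i
    refine Real.le_sqrt_of_sq_le ?_
    refine Finset.sum_sq_le_sum_mul_sum_of_sq_le_mul _
      (fun k _ => mul_nonneg (hW0 _ _) (Real.exp_pos _).le)
      (fun k _ => mul_nonneg (hW0 _ _) (Real.exp_pos _).le) fun k _ => ?_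
    have : Real.exp (-t k) * Real.exp (t k) = 1 := by rw [← Real.exp_add]; simp
    exact le_of_eq (by linear_combination (-(W i k) ^ 2) * this)
  have h := lintegral_boundary_le_one (ι := S) (W := W.submatrix (↑) (↑)) (hW.submatrix _)
    (fun i j => hW0 _ _) (fun i => hd _) (a := fun i => ∑ k ∈ Sᶜ, W i k * Real.exp (-t k))
    (ε := fun i => ∑ k ∈ Sᶜ, W i k * Real.exp (t k)) (m := fun i => ∑ k ∈ Sᶜ, W i k)
    (fun i => Finset.sum_nonneg fun k _ => mul_nonneg (hW0 _ _) (Real.exp_pos _).le)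
    (fun i => Finset.sum_nonneg fun k _ => mul_nonneg (hW0 _ _) (Real.exp_pos _).le) hcs
  refine le_trans (le_of_eq ?_) h
  rw [lmarginal]
  refine lintegral_congr fun τ => ?_
  set t' := Function.updateFinset t S τ with ht'
  have hin : ∀ i : S, t' i = τ i := fun i => by simp [ht', Function.updateFinset]
  have hout : ∀ k ∈ Sᶜ, t' k = t k := fun k hk => by
    simp [ht', Function.updateFinset, Finset.mem_compl.1 hk]
  have hE : touchEnergy W S t' = boundaryEnergy (W.submatrix ((↑) : S → V) (↑))
      (fun i => ∑ k ∈ Sᶜ, W i k * Real.exp (-t k)) (fun i => ∑ k ∈ Sᶜ, W i k * Real.exp (t k))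
      (fun i => ∑ k ∈ Sᶜ, W i k) τ := by
    rw [touchEnergy, boundaryEnergy, ← Finset.sum_coe_sort S, ← Finset.sum_coe_sort S]
    have h1 : ∀ i : S, ∑ j ∈ S, W i j * (Real.cosh (t' i - t' j) - 1) =
        ∑ j : S, W i j * (Real.cosh (τ i - τ j) - 1) := fun i => by
      rw [← Finset.sum_coe_sort S]
      exact Finset.sum_congr rfl fun j _ => by rw [hin, hin]
    have h2 : ∀ i : S, ∑ j ∈ Sᶜ, W i j * (Real.cosh (t' i - t' j) - 1) =
        (∑ k ∈ Sᶜ, W i k * Real.exp (-t k)) * Real.exp (τ i) / 2 +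
          (∑ k ∈ Sᶜ, W i k * Real.exp (t k)) * Real.exp (-τ i) / 2 - ∑ k ∈ Sᶜ, W i k := fun i => by
      rw [Finset.sum_mul, Finset.sum_mul, Finset.sum_div, Finset.sum_div,
        ← Finset.sum_add_distrib, ← Finset.sum_sub_distrib]
      refine Finset.sum_congr rfl fun k hk => ?_
      rw [hin, hout k hk, Real.cosh_eq]
      have e1 : Real.exp (τ i - t k) = Real.exp (-t k) * Real.exp (τ i) := by
        rw [← Real.exp_add]; congr 1; ring
      have e2 : Real.exp (-(τ i - t k)) = Real.exp (t k) * Real.exp (-τ i) := by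
        rw [← Real.exp_add]; congr 1; ring
      rw [e1, e2]; ring
    simp only [h1, h2, Matrix.submatrix_apply]
  congr 1
  rw [pathDensity, adjugate_rowRestrict_self _ hx, det_rowRestrict, Fintype.card_coe, sub_self,
    zero_div, Real.exp_zero, mul_one]
  congr 1
  · congr 3
    rw [← Finset.sum_coe_sort]
    exact congrArg _ (Finset.sum_congr rfl fun i _ => hin i)
  · congr 2
    ext i j
    rw [Matrix.submatrix_apply, dirichletMatrix, dirichletMatrix, Matrix.of_apply, Matrix.of_apply]
    by_cases hij : i = j
    · subst hij
      rw [if_pos rfl, if_pos rfl, hε i i.2, zero_mul, add_zero, hin,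
        ← Finset.sum_add_sum_compl S, ← Finset.sum_coe_sort S, Finset.sum_mul]
      congr 1
      · exact Finset.sum_congr rfl fun l _ => by rw [hin]; rfl
      · refine Finset.sum_congr rfl fun k hk => ?_
        rw [hout k hk, add_comm, Real.exp_add]; ring
    · rw [if_neg hij, if_neg (fun h => hij (Subtype.ext h)), hin, hin]; rfl

/-- Induction on `S`. If the path goes to `z`, the coordinates other than `t_z` are integrated
first, with a bound uniform in the frozen values. The step weight depends only on `t_y - t_z`, so
integrating `t_z` gives `stepIntegral` by translation invariance. If `y = x` the path has ended and
the boundary-field bound takes care of the rest. -/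
theorem lmarginal_pathDensity_le {W : Matrix V V ℝ} (hW : W.IsSymm) (hW0 : ∀ i j, 0 ≤ W i j)
    (hd : ∀ i, W i i = 0) {ε : V → ℝ} {x : V} (n : ℕ) (S : Finset V) (hn : S.card = n)
    (hε : ∀ i ∈ S, ε i = 0) (y : V) (hy : y ∉ S) (hx : x ∈ insert y S) (t : V → ℝ) :
    (∫⋯∫⁻_S, (fun t => ENNReal.ofReal (pathDensity W ε x S y t)) ∂fun _ => volume) t ≤
      pathSum (fun i j => stepIntegral (W i j)) x n S y := by
  induction n generalizing S y t with
  | zero =>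
    obtain rfl := Finset.card_eq_zero.1 hn
    obtain rfl : x = y := by simpa using hx
    rw [pathSum_self]
    exact lmarginal_pathDensity_self hW hW0 hd hε hy t
  | succ n ih =>
    by_cases hyx : y = x
    · subst hyx
      rw [pathSum_self]
      exact lmarginal_pathDensity_self hW hW0 hd hε hy t
    have hxS : x ∈ S := by
      rcases Finset.mem_insert.1 hx with h | h
      · exact absurd h.symm hyx
      · exact h
    rw [pathSum, if_neg hyx]
    have hk : ∀ z, Measurable fun t : V → ℝ => ENNReal.ofReal (stepWeight (W y z) (t y - t z)) :=
      fun z => by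
        have := continuous_stepWeight
        have h2 : Continuous fun t : V → ℝ => stepWeight (W y z) (t y - t z) :=
          this.comp (f := fun t : V → ℝ => (W y z, t y - t z)) (by fun_prop)
        exact h2.measurable.ennreal_ofReal
    have hm : ∀ z, Measurable fun t : V → ℝ => ENNReal.ofReal (stepWeight (W y z) (t y - t z)) *
        ENNReal.ofReal (pathDensity W ε x (S.erase z) z t) := fun z =>
      (hk z).mul (measurable_pathDensity W ε x _ z)
    calc _ ≤ (∫⋯∫⁻_S, (fun t => ∑ z ∈ S, ENNReal.ofReal (stepWeight (W y z) (t y - t z)) *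
            ENNReal.ofReal (pathDensity W ε x (S.erase z) z t)) ∂fun _ => volume) t := by
          refine lmarginal_mono (fun t => ?_) t
          refine (ENNReal.ofReal_le_ofReal (pathDensity_le_sum hW hW0 ε hy hxS t)).trans
            (le_of_eq ?_)
          rw [ENNReal.ofReal_sum_of_nonneg fun z _ =>
            mul_nonneg (stepWeight_nonneg _ _) (pathDensity_nonneg _ _ _ _ _ _)]
          exact Finset.sum_congr rfl fun z _ => ENNReal.ofReal_mul (stepWeight_nonneg _ _)
      _ = ∑ z ∈ S, (∫⋯∫⁻_S, (fun t => ENNReal.ofReal (stepWeight (W y z) (t y - t z)) *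
            ENNReal.ofReal (pathDensity W ε x (S.erase z) z t)) ∂fun _ => volume) t := by
          simp only [lmarginal]
          exact lintegral_finsetSum _ fun z _ => (hm z).comp measurable_updateFinset
      _ ≤ _ := by
          refine Finset.sum_le_sum fun z hz => ?_
          have hyz : y ≠ z := fun h => hy (h ▸ hz)
          rw [lmarginal_erase _ (hm z) hz]
          have hstep : ∀ s : ℝ, (∫⋯∫⁻_S.erase z,
              (fun t => ENNReal.ofReal (stepWeight (W y z) (t y - t z)) *
                ENNReal.ofReal (pathDensity W ε x (S.erase z) z t)) ∂fun _ => volume)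
                  (Function.update t z s) ≤
              ENNReal.ofReal (stepWeight (W y z) (t y - s)) *
                pathSum (fun i j => stepIntegral (W i j)) x n (S.erase z) z := by
            intro s
            have hI := ih (S.erase z) (by rw [Finset.card_erase_of_mem hz, hn]; rfl)
              (fun i hi => hε i (Finset.mem_of_mem_erase hi)) z (Finset.notMem_erase z S)
              (by rw [Finset.insert_erase hz]; exact hxS) (Function.update t z s)
            refine le_trans (le_of_eq ?_) (mul_le_mul_right hI _)
            rw [lmarginal, lmarginal, ← lintegral_const_mul' _ _ ENNReal.ofReal_ne_top]
            refine lintegral_congr fun τ => ?_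
            have hyS : y ∉ S.erase z := fun h => hy (Finset.mem_of_mem_erase h)
            simp [Function.updateFinset, hyS, hyz]
          refine (lintegral_mono hstep).trans ?_
          rw [lintegral_mul_const _ (by
            have := continuous_stepWeight
            have h2 : Continuous fun s : ℝ => stepWeight (W y z) (t y - s) :=
              this.comp (f := fun s : ℝ => (W y z, t y - s)) (by fun_prop)
            exact h2.measurable.ennreal_ofReal),
            lintegral_sub_left_eq_self (fun s => ENNReal.ofReal (stepWeight (W y z) s))]
          rfl

end PathExpansion

/-! ### The pinned sigma model -/

/-- Gaussian domination: `cosh s - 1 = 2 sinh² (s/2) ≥ s²/2`. -/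
lemma integrable_exp_cosh {w : ℝ} (hw : 0 < w) :
    Integrable fun s : ℝ => Real.exp (-(w * (Real.cosh s - 1))) := by
  have hc := Real.continuous_cosh
  refine (integrable_exp_neg_mul_sq (b := w / 2) (by positivity)).mono'
    (by fun_prop) (ae_of_all _ fun s => ?_)
  rw [Real.norm_eq_abs, Real.abs_exp, Real.exp_le_exp]
  have h1 : Real.cosh s = 1 + 2 * Real.sinh (s / 2) ^ 2 := by
    have := Real.cosh_two_mul (s / 2)
    rw [show 2 * (s / 2) = s by ring, Real.cosh_sq] at this
    linarith
  have h2 : (s / 2) ^ 2 ≤ Real.sinh (s / 2) ^ 2 := by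
    rw [sq_le_sq, Real.abs_sinh]
    exact Real.self_le_sinh_iff.2 (abs_nonneg _)
  rw [h1]
  nlinarith

lemma stepIntegral_eq_ofReal_besselI {η : ℝ} (hη : 0 < η) :
    stepIntegral η = ENNReal.ofReal (besselI η) := by
  rw [stepIntegral, ← ofReal_integral_eq_lintegral_ofReal]
  · congr 1
    rw [besselI, ← integral_const_mul]
    refine integral_congr_ae (ae_of_all _ fun s => ?_)
    simp only [stepWeight]; ring
  · exact ((integrable_exp_cosh hη).const_mul _).const_mul _
  · exact ae_of_all _ fun s => stepWeight_nonneg _ _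

lemma besselI_nonneg (η : ℝ) : 0 ≤ besselI η :=
  mul_nonneg (Real.sqrt_nonneg _) (integral_nonneg fun t => by positivity)

section Model

variable {d : ℕ}

lemma weight_comm (β : Edge d → ℝ) (i j : Fin d → ℤ) : weight β i j = weight β j i := by
  unfold weight
  by_cases h : (lattice d).Adj i j
  · rw [dif_pos h, dif_pos h.symm]
    congr 1
    exact Subtype.ext Sym2.eq_swap
  · rw [dif_neg h, dif_neg fun h' => h h'.symm]

lemma weight_self (β : Edge d → ℝ) (i : Fin d → ℤ) : weight β i i = 0 := by
  unfold weight
  rw [dif_neg (lattice d).irrefl]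

lemma weight_nonneg {β : Edge d → ℝ} (hβ : ∀ e, 0 ≤ β e) (i j : Fin d → ℤ) : 0 ≤ weight β i j := by
  unfold weight
  split_ifs
  · exact hβ _
  · exact le_rfl

/-- The weights between the vertices of `Λ`, as a matrix. -/
def weightMatrix (Λ : Finset (Fin d → ℤ)) (β : Edge d → ℝ) : Matrix Λ Λ ℝ :=
  Matrix.of fun i j => weight β i j

lemma matA_eq_dirichletMatrix (Λ : Finset (Fin d → ℤ)) (ε : (Fin d → ℤ) → ℝ) (β : Edge d → ℝ)
    (t : Λ → ℝ) : matA Λ ε β t = dirichletMatrix (weightMatrix Λ β) (fun i => ε i) t := by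
  ext i j
  by_cases h : i = j <;> simp [matA, dirichletMatrix, weightMatrix, h]

lemma gradEnergy_eq_touchEnergy (Λ : Finset (Fin d → ℤ)) (β : Edge d → ℝ) (t : Λ → ℝ) :
    gradEnergy Λ β t = touchEnergy (weightMatrix Λ β) Finset.univ t := by
  rw [gradEnergy, touchEnergy, Finset.compl_univ]
  simp [weightMatrix]

lemma continuous_density (Λ : Finset (Fin d → ℤ)) (ε : (Fin d → ℤ) → ℝ) (β : Edge d → ℝ) :
    Continuous (density Λ ε β) := by
  have hc := Real.continuous_cosh
  have h1 : Continuous (gradEnergy Λ β) := by unfold gradEnergy; fun_prop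
  have h2 : Continuous (pinEnergy Λ ε) := by unfold pinEnergy; fun_prop
  have h3 : Continuous fun t => (matA Λ ε β t).det := by
    simp only [matA_eq_dirichletMatrix]
    convert (continuous_dirichletMatrix (weightMatrix Λ β) (fun i => ε i)).matrix_det
  have h4 : Continuous fun t : Λ → ℝ => Real.exp (-∑ k : Λ, t k) := by fun_prop
  exact (((continuous_const.mul h4).mul (Real.continuous_exp.comp h1.neg)).mul
    (Real.continuous_exp.comp h2.neg)).mul (Real.continuous_sqrt.comp h3)

lemma colSum_dirichletMatrix {V : Type*} [Fintype V] [DecidableEq V] {W : Matrix V V ℝ}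
    (hW : W.IsSymm) (hd : ∀ i, W i i = 0) (ε t : V → ℝ) (j : V) :
    ∑ i, dirichletMatrix W ε t i j = ε j * Real.exp (t j) := by
  have h : ∀ i, dirichletMatrix W ε t i j =
      (if i = j then ∑ l, W j l * Real.exp (t j + t l) + ε j * Real.exp (t j) else 0) -
        W j i * Real.exp (t j + t i) := by
    intro i
    by_cases hij : i = j
    · subst hij; simp [dirichletMatrix, hd]
    · simp only [dirichletMatrix, Matrix.of_apply, if_neg hij]
      rw [hW.apply, add_comm (t i)]; ring
  simp only [h, Finset.sum_sub_distrib, Finset.sum_ite_eq', Finset.mem_univ, if_true]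
  ring

/-- The moment `μ(e^{t_x / 2})` is bounded by a sum over self-avoiding paths. -/
theorem expMoment_le_pathSum (Λ : Finset (Fin d → ℤ)) {η : ℝ} (hη : 0 < η) {β : Edge d → ℝ}
    (hβ : ∀ e, 0 ≤ β e) {o : Λ} (ho : (o : Fin d → ℤ) = 0) (x : Λ) :
    expMoment Λ η β x ≤ ENNReal.ofReal (besselI η) *
      pathSum (fun i j : Λ => stepIntegral (weight β i j)) x (Finset.univ.erase o).card
        (Finset.univ.erase o) o := by
  set W := weightMatrix Λ β with hWdef
  set ε : Λ → ℝ := fun i => (Pi.single 0 η : (Fin d → ℤ) → ℝ) i with hε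
  set S : Finset Λ := Finset.univ.erase o with hS
  have hW : W.IsSymm := Matrix.IsSymm.ext fun i j => weight_comm β _ _
  have hW0 : ∀ i j, 0 ≤ W i j := fun i j => weight_nonneg hβ _ _
  have hd : ∀ i, W i i = 0 := fun i => weight_self β _
  have hεo : ε o = η := by simp [hε, ho]
  have hεS : ∀ i, i ≠ o → ε i = 0 := fun i hi => by
    have : (i : Fin d → ℤ) ≠ 0 := fun h => hi (Subtype.ext (h.trans ho.symm))
    simp [hε, this]
  have hoS : insert o S = Finset.univ := Finset.insert_erase (Finset.mem_univ o)
  have hpt : ∀ t : Λ → ℝ, density Λ (Pi.single 0 η) β t * Real.exp (t x / 2) ≤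
      stepWeight η (t o) * pathDensity W ε x S o t := by
    intro t
    -- The pinning acts as one extra step of weight `η`: `√η` comes from this factor, the
    -- exponential from the pinning energy.
    have hdet : (matA Λ (Pi.single 0 η) β t).det = η * Real.exp (t o) *
        (dirichletMatrix W ε t).adjugate o x := by
      rw [matA_eq_dirichletMatrix]
      have := det_eq_colSum_mul_adjugate (dirichletMatrix W ε t) o x (η * Real.exp (t o))
        (fun j => by
          rw [colSum_dirichletMatrix hW hd]
          split_ifs with h
          · rw [h, hεo]
          · rw [hεS j h, zero_mul])
      rw [← this]
    have hpin : pinEnergy Λ (Pi.single 0 η) t = η * (Real.cosh (t o) - 1) := by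
      rw [pinEnergy, Finset.sum_eq_single o]
      · change ε o * _ = _
        rw [hεo]
      · intro i _ hi
        change ε i * _ = _
        rw [hεS i hi, zero_mul]
      · simp
    have hgrad : gradEnergy Λ β t = touchEnergy W S t := by
      rw [gradEnergy_eq_touchEnergy, ← hoS, touchEnergy_insert hW (Finset.notMem_erase o _), hoS,
        Finset.compl_univ, Finset.sum_empty, add_zero]
    have hsum : ∑ k, t k = t o + ∑ k ∈ S, t k := (Finset.add_sum_erase _ t (Finset.mem_univ o)).symm
    have hcard : Fintype.card Λ = S.card + 1 := by
      rw [hS, Finset.card_erase_add_one (Finset.mem_univ o), Finset.card_univ]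
    rw [density, pathDensity, hdet, hpin, hgrad, hsum, hoS, rowRestrict_univ, stepWeight,
      Finset.prod_const, Finset.card_univ, hcard, pow_succ,
      Real.sqrt_mul (x := η * Real.exp (t o)) (by positivity), Real.sqrt_mul hη.le,
      ← Real.exp_half]
    have hexp : Real.exp (-(t o + ∑ k ∈ S, t k)) * Real.exp (t o / 2) * Real.exp (t x / 2) =
        Real.exp (-∑ k ∈ S, t k) * Real.exp ((t x - t o) / 2) := by
      rw [← Real.exp_add, ← Real.exp_add, ← Real.exp_add]; congr 1; ring
    refine le_of_eq ?_
    linear_combination ((Real.sqrt (2 * Real.pi))⁻¹ ^ S.card * (Real.sqrt (2 * Real.pi))⁻¹ *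
      Real.exp (-touchEnergy W S t) * Real.exp (-(η * (Real.cosh (t o) - 1))) * Real.sqrt η *
        Real.sqrt ((dirichletMatrix W ε t).adjugate o x)) * hexp
  have hm1 : Measurable fun s : ℝ => ENNReal.ofReal (stepWeight η s) :=
    (continuous_stepWeight.comp (f := fun s : ℝ => (η, s))
      (by fun_prop)).measurable.ennreal_ofReal
  have hm : Measurable fun t : Λ → ℝ => ENNReal.ofReal (stepWeight η (t o)) *
      ENNReal.ofReal (pathDensity W ε x S o t) :=
    (hm1.comp (measurable_pi_apply o)).mul (measurable_pathDensity W ε x S o)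
  have hstep : ∀ s : ℝ, (∫⋯∫⁻_S, (fun t : Λ → ℝ => ENNReal.ofReal (stepWeight η (t o)) *
      ENNReal.ofReal (pathDensity W ε x S o t)) ∂fun _ => volume) (Function.update 0 o s) ≤
      ENNReal.ofReal (stepWeight η s) *
        pathSum (fun i j : Λ => stepIntegral (weight β i j)) x S.card S o := by
    intro s
    have hI := lmarginal_pathDensity_le hW hW0 hd (ε := ε) (x := x) S.card S rfl
      (fun i hi => hεS i (Finset.ne_of_mem_erase hi)) o (Finset.notMem_erase o _)
      (by rw [hoS]; exact Finset.mem_univ x) (Function.update 0 o s)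
    refine le_trans (le_of_eq ?_) (mul_le_mul_right hI _)
    rw [lmarginal, lmarginal, ← lintegral_const_mul' _ _ ENNReal.ofReal_ne_top]
    refine lintegral_congr fun τ => ?_
    simp [Function.updateFinset, hS]
  calc expMoment Λ η β x
      = ∫⁻ t : Λ → ℝ, ENNReal.ofReal (density Λ (Pi.single 0 η) β t * Real.exp (t x / 2)) := by
        rw [expMoment, mu, lintegral_withDensity_eq_lintegral_mul _
          (continuous_density Λ _ β).measurable.ennreal_ofReal (by fun_prop)]
        refine lintegral_congr fun t => ?_
        rw [Pi.mul_apply, ← ENNReal.ofReal_mul]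
        unfold density; positivity
    _ ≤ ∫⁻ t : Λ → ℝ, ENNReal.ofReal (stepWeight η (t o)) *
          ENNReal.ofReal (pathDensity W ε x S o t) := by
        refine lintegral_mono fun t => ?_
        rw [← ENNReal.ofReal_mul (stepWeight_nonneg _ _)]
        exact ENNReal.ofReal_le_ofReal (hpt t)
    _ = ∫⁻ s : ℝ, (∫⋯∫⁻_S, (fun t : Λ → ℝ => ENNReal.ofReal (stepWeight η (t o)) *
          ENNReal.ofReal (pathDensity W ε x S o t)) ∂fun _ => volume)
            (Function.update 0 o s) := by
        have h := lmarginal_erase (μ := fun _ : Λ => (volume : Measure ℝ)) _ hm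
          (Finset.mem_univ o) 0
        rw [lmarginal_univ] at h
        exact h
    _ ≤ ∫⁻ s : ℝ, ENNReal.ofReal (stepWeight η s) *
          pathSum (fun i j : Λ => stepIntegral (weight β i j)) x S.card S o :=
        lintegral_mono hstep
    _ = _ := by
        rw [lintegral_mul_const _ hm1, ← stepIntegral_eq_ofReal_besselI hη]
        rfl

end Model

/-! ### Gamma moments of the step integrals -/

/-- The constant `∫ (cosh s)^{-1/2} ds / √(2π)`. -/
def coshConst : ℝ≥0∞ :=
  ∫⁻ s : ℝ, ENNReal.ofReal ((Real.sqrt (2 * Real.pi))⁻¹ * Real.cosh s ^ (-(1 / 2) : ℝ))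

lemma cosh_rpow_neg_half_le (s : ℝ) :
    Real.cosh s ^ (-(1 / 2) : ℝ) ≤ Real.sqrt 2 * Real.exp (-|s| / 2) := by
  have h1 : Real.exp |s| / 2 ≤ Real.cosh s := by
    rw [← Real.cosh_abs, Real.cosh_eq]
    have := Real.exp_pos (-|s|)
    linarith
  refine (Real.rpow_le_rpow_of_nonpos (by positivity) h1 (by norm_num)).trans (le_of_eq ?_)
  rw [Real.rpow_neg (by positivity), ← Real.sqrt_eq_rpow, Real.sqrt_div (Real.exp_pos _).le,
    ← Real.exp_half, inv_div, neg_div, Real.exp_neg, div_eq_mul_inv]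

lemma coshConst_ne_top : coshConst ≠ ⊤ := by
  have hi : Integrable fun s : ℝ => Real.exp (-|s| / 2) := by
    rw [← integrableOn_univ, ← Set.Iic_union_Ioi (a := (0 : ℝ))]
    refine IntegrableOn.union ?_ ?_
    · refine (integrableOn_exp_mul_Iic (a := 1 / 2) (by norm_num) 0).congr_fun (fun s hs => ?_)
        measurableSet_Iic
      simp only
      rw [abs_of_nonpos hs]; congr 1; ring
    · refine (exp_neg_integrableOn_Ioi 0 (b := 1 / 2) (by norm_num)).congr_fun (fun s hs => ?_)
        measurableSet_Ioi
      simp only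
      rw [abs_of_pos hs]; congr 1; ring
  have hi2 := (hi.const_mul (Real.sqrt 2)).const_mul (Real.sqrt (2 * Real.pi))⁻¹
  refine ne_top_of_le_ne_top hi2.lintegral_lt_top.ne (lintegral_mono fun s => ?_)
  refine ENNReal.ofReal_le_ofReal ?_
  gcongr
  exact cosh_rpow_neg_half_le s

lemma measurable_stepIntegral : Measurable stepIntegral :=
  Measurable.lintegral_prod_right' (f := fun z : ℝ × ℝ => ENNReal.ofReal (stepWeight z.1 z.2))
    continuous_stepWeight.measurable.ennreal_ofReal

lemma lintegral_gammaMeasure (a : ℝ) {g : ℝ → ℝ≥0∞} (hg : Measurable g) :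
    ∫⁻ b, g b ∂gammaMeasure a 1 = ∫⁻ b in Set.Ioi (0 : ℝ),
      ENNReal.ofReal ((Real.Gamma a)⁻¹ * b ^ (a - 1) * Real.exp (-b)) * g b := by
  have hm : Measurable (gammaPDF a 1) := (measurable_gammaPDFReal a 1).ennreal_ofReal
  rw [gammaMeasure, lintegral_withDensity_eq_lintegral_mul _ hm hg, ← setLIntegral_univ,
    ← Set.Iio_union_Ici (a := (0:ℝ)), lintegral_union measurableSet_Ici (by
      rw [Set.disjoint_left]; intro x hx hx'; exact absurd (Set.mem_Ici.1 hx') (not_le.2 hx)),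
    setLIntegral_congr (Ioi_ae_eq_Ici (a := (0:ℝ))).symm,
    setLIntegral_congr_fun (g := fun _ => 0) measurableSet_Iio
      (fun x hx => by rw [Pi.mul_apply, gammaPDF_of_neg hx, zero_mul])]
  simp only [lintegral_const, zero_mul, zero_add]
  refine setLIntegral_congr_fun measurableSet_Ioi fun x hx => ?_
  rw [Pi.mul_apply, gammaPDF_of_nonneg (le_of_lt hx), Real.one_rpow, one_div, one_mul]

lemma ae_nonneg_gammaMeasure (a : ℝ) : ∀ᵐ b ∂gammaMeasure a 1, 0 ≤ b := by
  rw [ae_iff, gammaMeasure]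
  have : {b : ℝ | ¬ 0 ≤ b} = Set.Iio 0 := by ext; simp
  rw [this, withDensity_apply _ measurableSet_Iio,
    setLIntegral_congr_fun (g := fun _ => 0) measurableSet_Iio (fun x hx => gammaPDF_of_neg hx)]
  simp

lemma lintegral_rpow_gammaMeasure {a p : ℝ} (ha : 0 < a) (hp : 0 ≤ p) :
    ∫⁻ b, ENNReal.ofReal (b ^ p) ∂gammaMeasure a 1 =
      ENNReal.ofReal (Real.Gamma (a + p) / Real.Gamma a) := by
  have hG := Real.Gamma_pos_of_pos ha
  rw [lintegral_gammaMeasure a (by fun_prop)]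
  have h := lintegral_rpow_mul_exp (b := a + p) (r := 1) (by linarith) one_pos
  rw [Real.one_rpow, div_one] at h
  rw [div_eq_inv_mul, ENNReal.ofReal_mul (inv_nonneg.2 hG.le), ← h,
    ← lintegral_const_mul _ (by fun_prop)]
  refine setLIntegral_congr_fun measurableSet_Ioi fun x hx => ?_
  have hx' : (0 : ℝ) < x := hx
  rw [← ENNReal.ofReal_mul (by positivity), ← ENNReal.ofReal_mul (by positivity)]
  congr 1
  rw [show a + p - 1 = (a - 1) + p by ring, Real.rpow_add hx', one_mul]
  ring

/-- Swap the integrals. The exponentials combine to `e^{-b cosh s}`, so the integral in `b` is `Γ(a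
+ p + 1/2) (cosh s)^{-(a + p + 1/2)}`; as `cosh ≥ 1`, the integral over `s` is bounded uniformly in
`a` and `p`. -/
lemma lintegral_rpow_mul_stepIntegral_le {a p : ℝ} (ha : 0 < a) (hp : 0 ≤ p) :
    ∫⁻ b, ENNReal.ofReal (b ^ p) * stepIntegral b ∂gammaMeasure a 1 ≤
      ENNReal.ofReal (Real.Gamma (a + p + 1 / 2) / Real.Gamma a) * coshConst := by
  have hG := Real.Gamma_pos_of_pos ha
  have hG' := Real.Gamma_pos_of_pos (s := a + p + 1 / 2) (by linarith)
  have hms : Measurable fun z : ℝ × ℝ => stepWeight z.1 z.2 := continuous_stepWeight.measurable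
  have hmg : Measurable fun b : ℝ => ENNReal.ofReal (b ^ p) * stepIntegral b :=
    (by fun_prop : Measurable fun b : ℝ => ENNReal.ofReal (b ^ p)).mul measurable_stepIntegral
  rw [lintegral_gammaMeasure a hmg]
  simp only [stepIntegral, ← mul_assoc]
  have e1 : ∀ b : ℝ, ENNReal.ofReal ((Real.Gamma a)⁻¹ * b ^ (a - 1) * Real.exp (-b)) *
      ENNReal.ofReal (b ^ p) * ∫⁻ s, ENNReal.ofReal (stepWeight b s) =
      ∫⁻ s, ENNReal.ofReal ((Real.Gamma a)⁻¹ * b ^ (a - 1) * Real.exp (-b)) *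
        ENNReal.ofReal (b ^ p) * ENNReal.ofReal (stepWeight b s) := fun b => by
    rw [lintegral_const_mul' _ _ (ENNReal.mul_ne_top ENNReal.ofReal_ne_top ENNReal.ofReal_ne_top)]
  simp only [e1]
  rw [lintegral_lintegral_swap (by
    refine Measurable.aemeasurable ?_
    simp only [Function.uncurry_def]
    exact (by fun_prop : Measurable fun z : ℝ × ℝ =>
      ENNReal.ofReal ((Real.Gamma a)⁻¹ * z.1 ^ (a - 1) * Real.exp (-z.1)) *
        ENNReal.ofReal (z.1 ^ p)).mul hms.ennreal_ofReal)]
  rw [coshConst, ← lintegral_const_mul' _ _ ENNReal.ofReal_ne_top]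
  refine lintegral_mono fun s => ?_
  have hc := Real.cosh_pos s
  have h := lintegral_rpow_mul_exp (b := a + p + 1 / 2) (r := Real.cosh s) (by linarith) hc
  have e2 : ∫⁻ b in Set.Ioi (0 : ℝ),
      ENNReal.ofReal ((Real.Gamma a)⁻¹ * b ^ (a - 1) * Real.exp (-b)) *
        ENNReal.ofReal (b ^ p) * ENNReal.ofReal (stepWeight b s) =
      ENNReal.ofReal ((Real.Gamma a)⁻¹ * (Real.sqrt (2 * Real.pi))⁻¹) *
        ∫⁻ b in Set.Ioi (0 : ℝ), ENNReal.ofReal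
          (b ^ (a + p + 1 / 2 - 1) * Real.exp (-(Real.cosh s * b))) := by
    rw [← lintegral_const_mul _ (by fun_prop)]
    refine setLIntegral_congr_fun measurableSet_Ioi fun b hb => ?_
    have hb' : (0 : ℝ) < b := hb
    rw [← ENNReal.ofReal_mul (by positivity), ← ENNReal.ofReal_mul (by positivity),
      ← ENNReal.ofReal_mul (by positivity)]
    congr 1
    have q1 : b ^ (a + p + 1 / 2 - 1) = b ^ (a - 1) * b ^ p * Real.sqrt b := by
      rw [Real.sqrt_eq_rpow, ← Real.rpow_add hb', ← Real.rpow_add hb']; congr 1; ring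
    have q2 : Real.exp (-(Real.cosh s * b)) =
        Real.exp (-b) * Real.exp (-(b * (Real.cosh s - 1))) := by
      rw [← Real.exp_add]; congr 1; ring
    rw [q1, q2, stepWeight]; ring
  rw [e2, h, ← ENNReal.ofReal_mul (by positivity), ← ENNReal.ofReal_mul (by positivity)]
  refine ENNReal.ofReal_le_ofReal ?_
  have h3 : (Real.cosh s ^ (a + p + 1 / 2))⁻¹ ≤ Real.cosh s ^ (-(1 / 2) : ℝ) := by
    rw [← Real.rpow_neg hc.le]
    exact Real.rpow_le_rpow_of_exponent_le (Real.one_le_cosh s) (by linarith)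
  calc _ = Real.Gamma (a + p + 1 / 2) / Real.Gamma a * ((Real.sqrt (2 * Real.pi))⁻¹ *
        (Real.cosh s ^ (a + p + 1 / 2))⁻¹) := by ring
    _ ≤ _ := by gcongr

/-- The mean step integral under `Gamma(a, 1)` is small when `a` is small. -/
lemma exists_lintegral_stepIntegral_le {κ : ℝ} (hκ : 0 < κ) :
    ∃ ac : ℝ, 0 < ac ∧ ∀ a, 0 < a → a < ac →
      ∫⁻ b, stepIntegral b ∂gammaMeasure a 1 ≤ ENNReal.ofReal κ := by
  -- Writing `1 / Γ(a)` as `a / Γ(a + 1)` makes the bound continuous at `a = 0`, where it vanishes.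
  set f : ℝ → ℝ := fun a => Real.Gamma (a + 1 / 2) * (a / Real.Gamma (a + 1)) *
    coshConst.toReal with hf
  have hne : ∀ c : ℝ, 0 < c → ∀ m : ℕ, c ≠ -m := fun c hc m h => by
    have : (0 : ℝ) ≤ m := m.cast_nonneg
    linarith
  have hcont : ContinuousAt f 0 := by
    have h1 : ContinuousAt (fun a : ℝ => Real.Gamma (a + 1 / 2)) 0 :=
      ContinuousAt.comp (g := Real.Gamma) (f := fun a : ℝ => a + 1 / 2) (x := 0)
        (by simpa using (Real.differentiableAt_Gamma (hne (1 / 2) (by norm_num))).continuousAt)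
        (by fun_prop)
    have h2 : ContinuousAt (fun a : ℝ => Real.Gamma (a + 1)) 0 :=
      ContinuousAt.comp (g := Real.Gamma) (f := fun a : ℝ => a + 1) (x := 0)
        (by simpa using (Real.differentiableAt_Gamma (hne 1 one_pos)).continuousAt)
        (by fun_prop)
    exact (h1.mul (continuousAt_id.div h2 (by simp))).mul continuousAt_const
  have hf0 : f 0 < κ := by simpa [hf] using hκ
  obtain ⟨ac, hac, h⟩ := Metric.eventually_nhds_iff.1 (hcont.eventually (gt_mem_nhds hf0))
  refine ⟨ac, hac, fun a ha haac => ?_⟩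
  have hfa := h (y := a) (by rw [Real.dist_eq, sub_zero, abs_of_pos ha]; exact haac)
  have hb := lintegral_rpow_mul_stepIntegral_le ha (p := 0) le_rfl
  simp only [Real.rpow_zero, ENNReal.ofReal_one, one_mul, add_zero] at hb
  refine hb.trans ?_
  rw [← ENNReal.ofReal_toReal coshConst_ne_top, ← ENNReal.ofReal_mul (div_nonneg
    (Real.Gamma_pos_of_pos (by linarith)).le (Real.Gamma_pos_of_pos ha).le)]
  refine ENNReal.ofReal_le_ofReal (le_trans (le_of_eq ?_) hfa.le)
  simp only [hf]
  have := (Real.Gamma_pos_of_pos ha).ne'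
  rw [Real.Gamma_add_one ha.ne']
  field_simp

/-! ### Expectation over the weights -/

section Lattice

variable {d : ℕ}

lemma l1norm_add_le (x y : Fin d → ℤ) : l1norm (x + y) ≤ l1norm x + l1norm y := by
  unfold l1norm
  rw [← Finset.sum_add_distrib]
  exact Finset.sum_le_sum fun i _ => Int.natAbs_add_le _ _

lemma l1norm_sub_le_of_adj {x y z : Fin d → ℤ} (h : (lattice d).Adj y z) :
    l1norm (x - y) ≤ l1norm (x - z) + 1 := by
  have h1 : l1norm (z - y) = 1 := h.symm
  have h2 := l1norm_add_le (x - z) (z - y)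
  rw [sub_add_sub_cancel, h1] at h2
  exact h2

open Classical in
-- Neighbours differ from `y` by an element of `{-1, 0, 1}^d`; this crude count suffices.
lemma card_filter_adj_le (Λ : Finset (Fin d → ℤ)) (S : Finset Λ) (y : Λ) :
    (S.filter fun z : Λ => (lattice d).Adj y z).card ≤ 3 ^ d := by
  have hc : (Fintype.piFinset fun _ : Fin d => Finset.Icc (-1 : ℤ) 1).card = 3 ^ d := by
    simp [Fintype.card_piFinset]
  rw [← hc]
  refine Finset.card_le_card_of_injOn (fun z : Λ => (y : Fin d → ℤ) - (z : Fin d → ℤ))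
    (fun z hz => ?_) fun z _ w _ h => Subtype.ext (sub_right_injective h)
  have h1 : l1norm ((y : Fin d → ℤ) - (z : Fin d → ℤ)) = 1 := (Finset.mem_filter.1 hz).2
  rw [Finset.mem_coe, Fintype.mem_piFinset]
  intro i
  have h2 : (((y : Fin d → ℤ) - (z : Fin d → ℤ)) i).natAbs ≤ 1 := by
    rw [← h1]
    exact Finset.single_le_sum (f := fun i => (((y : Fin d → ℤ) - (z : Fin d → ℤ)) i).natAbs)
      (fun _ _ => Nat.zero_le _) (Finset.mem_univ i)
  rw [Finset.mem_Icc]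
  dsimp only
  omega

/-- The edges with both endpoints in `U`. -/
def edgesWithin {Λ : Finset (Fin d → ℤ)} (U : Finset Λ) : Set (Edge d) :=
  {e | ∀ v ∈ (e : Sym2 (Fin d → ℤ)), ∃ u ∈ U, (u : Fin d → ℤ) = v}

lemma edgesWithin_mono {Λ : Finset (Fin d → ℤ)} {U U' : Finset Λ} (h : U ⊆ U') :
    edgesWithin U ⊆ edgesWithin U' := fun _ he v hv =>
  let ⟨u, hu, huv⟩ := he v hv
  ⟨u, h hu, huv⟩

/-- The `σ`-algebra generated by the weights of the edges in `T`. -/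
abbrev weightAlgebra {Ω : Type*} (β : Edge d → Ω → ℝ) (T : Set (Edge d)) : MeasurableSpace Ω :=
  ⨆ e ∈ T, MeasurableSpace.comap (β e) inferInstance

lemma weightAlgebra_mono {Ω : Type*} (β : Edge d → Ω → ℝ) {T T' : Set (Edge d)} (h : T ⊆ T') :
    weightAlgebra β T ≤ weightAlgebra β T' :=
  biSup_mono h

lemma measurable_weightAlgebra {Ω : Type*} (β : Edge d → Ω → ℝ) {T : Set (Edge d)} {e : Edge d}
    (he : e ∈ T) : Measurable[weightAlgebra β T] (β e) := by
  rw [measurable_iff_comap_le]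
  exact le_biSup (fun e => MeasurableSpace.comap (β e) inferInstance) he

/-- The source of independence: the paths continuing from `z` through `S` see only edges inside `S`,
hence not an edge from `y ∉ S` to `z`. -/
lemma measurable_pathSum {Ω : Type*} (β : Edge d → Ω → ℝ) {J : ℝ → ℝ≥0∞} (hJ : Measurable J)
    {Λ : Finset (Fin d → ℤ)} (x : Λ) (n : ℕ) (S : Finset Λ) (y : Λ) :
    Measurable[weightAlgebra β (edgesWithin (insert y S))] fun ω =>
      pathSum (fun i j : Λ => J (weight (fun e => β e ω) i j)) x n S y := by
  induction n generalizing S y with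
  | zero => simp only [pathSum]; exact @measurable_const _ _ _ _ _
  | succ n ih =>
    by_cases hyx : y = x
    · simp only [pathSum, if_pos hyx]; exact @measurable_const _ _ _ _ _
    · simp only [pathSum, if_neg hyx]
      refine @Finset.measurable_sum _ _ _ _ _ _ (_) _ _ fun z hz => ?_
      refine @Measurable.mul _ _ _ _ _ (_) _ _ ?_ ?_
      · by_cases h : (lattice d).Adj y z
        · simp only [weight, dif_pos h]
          refine hJ.comp (measurable_weightAlgebra β fun v hv => ?_)
          rcases Sym2.mem_iff.1 hv with rfl | rfl
          · exact ⟨y, Finset.mem_insert_self _ _, rfl⟩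
          · exact ⟨z, Finset.mem_insert_of_mem hz, rfl⟩
        · simp only [weight, dif_neg h]
          exact @measurable_const _ _ _ _ _
      · refine (ih (S.erase z) z).mono (weightAlgebra_mono β (edgesWithin_mono ?_)) le_rfl
        rw [Finset.insert_erase hz]
        exact Finset.subset_insert _ _

/-! ### Exponential decay of the averaged path sum. -/

section Expectation

variable {Ω : Type*} [MeasurableSpace Ω] {P : Measure Ω}
  {β : Edge d → Ω → ℝ} {γ : Measure ℝ}

lemma weightAlgebra_le (hβ : ∀ e, Measurable (β e)) (T : Set (Edge d)) :
    weightAlgebra β T ≤ ‹MeasurableSpace Ω› :=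
  iSup₂_le fun e _ => (hβ e).comap_le

lemma lintegral_mul_of_notMem (hβ : ∀ e, Measurable (β e)) (hlaw : ∀ e, HasLaw (β e) γ P)
    (hind : iIndepFun β P) {e : Edge d} {T : Set (Edge d)} (he : e ∉ T) {g : ℝ → ℝ≥0∞}
    (hg : Measurable g) {F : Ω → ℝ≥0∞} (hF : Measurable[weightAlgebra β T] F) :
    ∫⁻ ω, g (β e ω) * F ω ∂P = (∫⁻ b, g b ∂γ) * ∫⁻ ω, F ω ∂P := by
  have hindep : Indep (weightAlgebra β {e}) (weightAlgebra β T) P :=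
    indep_iSup_of_disjoint (fun e => (hβ e).comap_le) hind (Set.disjoint_singleton_left.2 he)
  have h := lintegral_mul_eq_lintegral_mul_lintegral_of_independent_measurableSpace
    (weightAlgebra_le hβ _) (weightAlgebra_le hβ _) hindep
    (hg.comp (measurable_weightAlgebra β (Set.mem_singleton e))) hF
  simp only [Function.comp_apply] at h
  rw [h, (hlaw e).lintegral_comp hg.aemeasurable]

/-- The first edge is independent of the later ones because `y` is never revisited. Each step costs
`κ` and has at most `3^d` choices. The extra weight `G` sits on an edge `e₀` at `x`; since paths
stop at `x`, they can cross `e₀` only in their last step, where `h3` controls the product `G * J`.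
-/
theorem lintegral_pathSum_le (hβ : ∀ e, Measurable (β e)) (hlaw : ∀ e, HasLaw (β e) γ P)
    (hind : iIndepFun β P) {J G : ℝ → ℝ≥0∞} (hJ : Measurable J) (hG : Measurable G) (hJ0 : J 0 = 0)
    {M κ : ℝ≥0∞} (hκ : 3 ^ d * κ ≤ 2⁻¹) (h1 : ∫⁻ b, G b ∂γ ≤ M) (h2 : ∫⁻ b, J b ∂γ ≤ κ)
    (h3 : ∫⁻ b, G b * J b ∂γ ≤ κ * M) {Λ : Finset (Fin d → ℤ)} (x : Λ) {e₀ : Edge d}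
    (hx : (x : Fin d → ℤ) ∈ (e₀ : Sym2 (Fin d → ℤ))) (n : ℕ) (S : Finset Λ) (y : Λ) (hy : y ∉ S) :
    ∫⁻ ω, G (β e₀ ω) * pathSum (fun i j : Λ => J (weight (fun e => β e ω) i j)) x n S y ∂P ≤
      M * 2⁻¹ ^ l1norm ((x : Fin d → ℤ) - (y : Fin d → ℤ)) := by
  classical
  have hself : ∀ n (S : Finset Λ), ∫⁻ ω, G (β e₀ ω) *
      pathSum (fun i j : Λ => J (weight (fun e => β e ω) i j)) x n S x ∂P ≤
      M * 2⁻¹ ^ l1norm ((x : Fin d → ℤ) - (x : Fin d → ℤ)) := fun n S => by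
    simp only [pathSum_self, mul_one]
    rw [(hlaw e₀).lintegral_comp hG.aemeasurable]
    simpa [l1norm] using h1
  induction n generalizing S y with
  | zero =>
    by_cases hyx : y = x
    · subst hyx; exact hself _ _
    · simp [pathSum, hyx]
  | succ n ih =>
    by_cases hyx : y = x
    · subst hyx; exact hself _ _
    set F : Λ → Ω → ℝ≥0∞ := fun z ω =>
      pathSum (fun i j : Λ => J (weight (fun e => β e ω) i j)) x n (S.erase z) z with hF
    have hFm : ∀ z ∈ S, Measurable[weightAlgebra β (edgesWithin S)] (F z) := fun z hz => by
      have := measurable_pathSum β hJ x n (S.erase z) z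
      rwa [Finset.insert_erase hz] at this
    have hFm' : ∀ z ∈ S, Measurable (F z) := fun z hz =>
      (hFm z hz).mono (weightAlgebra_le hβ _) le_rfl
    have hwm : ∀ z : Λ, Measurable fun ω => weight (fun e => β e ω) y z := fun z => by
      by_cases h : (lattice d).Adj y z
      · simp only [weight, dif_pos h]; exact hβ _
      · simp only [weight, dif_neg h]; exact measurable_const
    have hterm : ∀ z ∈ S, ∫⁻ ω, G (β e₀ ω) * (J (weight (fun e => β e ω) y z) * F z ω) ∂P ≤
        if (lattice d).Adj y z then κ * (M * (2 * 2⁻¹ ^ l1norm ((x : Fin d → ℤ) - (y : Fin d → ℤ))))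
        else 0 := by
      intro z hz
      split_ifs with hadj
      -- A step gains at most one unit of distance, a factor `2` that `3^d * κ ≤ 1/2` compensates.
      · have hdist : (2⁻¹ : ℝ≥0∞) ^ l1norm ((x : Fin d → ℤ) - (z : Fin d → ℤ)) ≤
            2 * 2⁻¹ ^ l1norm ((x : Fin d → ℤ) - (y : Fin d → ℤ)) := by
          have h := l1norm_sub_le_of_adj (x := (x : Fin d → ℤ)) hadj
          have h' : (2⁻¹ : ℝ≥0∞) ^ (l1norm ((x : Fin d → ℤ) - (z : Fin d → ℤ)) + 1) ≤
            2⁻¹ ^ l1norm ((x : Fin d → ℤ) - (y : Fin d → ℤ)) :=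
            pow_le_pow_right_of_le_one' (by simp) h
          calc (2⁻¹ : ℝ≥0∞) ^ l1norm ((x : Fin d → ℤ) - (z : Fin d → ℤ))
              = 2 * 2⁻¹ ^ (l1norm ((x : Fin d → ℤ) - (z : Fin d → ℤ)) + 1) := by
                rw [pow_succ', ← mul_assoc, ENNReal.mul_inv_cancel (by simp) (by simp), one_mul]
            _ ≤ _ := by gcongr
        refine le_trans ?_ (mul_le_mul_right (mul_le_mul_right hdist M) κ)
        simp only [weight, dif_pos hadj]
        by_cases he : (⟨s((y : Fin d → ℤ), (z : Fin d → ℤ)), hadj⟩ : Edge d) = e₀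
        · have hzx : z = x := by
            rw [← he] at hx
            rcases Sym2.mem_iff.1 hx with h | h
            · exact absurd (Subtype.ext h.symm) hyx
            · exact Subtype.ext h.symm
          subst hzx
          simp only [hF, pathSum_self, mul_one, he]
          rw [(hlaw e₀).lintegral_comp (f := fun b => G b * J b) (hG.mul hJ).aemeasurable]
          simpa [l1norm] using h3
        · have hmul : ∀ ω, G (β e₀ ω) * (J (β ⟨s((y : Fin d → ℤ), (z : Fin d → ℤ)), hadj⟩ ω) *
              F z ω) = J (β ⟨s((y : Fin d → ℤ), (z : Fin d → ℤ)), hadj⟩ ω) *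
                (G (β e₀ ω) * F z ω) := fun ω => by ring
          simp only [hmul]
          rw [lintegral_mul_of_notMem hβ hlaw hind (T := insert e₀ (edgesWithin S)) ?_ hJ ?_]
          · exact mul_le_mul' h2 (ih (S.erase z) z (Finset.notMem_erase z S))
          · rintro (h | h)
            · exact he h
            · obtain ⟨u, hu, huy⟩ := h y (Sym2.mem_mk_left _ _)
              exact hy (Subtype.ext huy ▸ hu)
          · refine @Measurable.mul _ _ _ _ _ (_) _ _ ?_ ?_
            · exact hG.comp (measurable_weightAlgebra β (Set.mem_insert _ _))
            · exact (hFm z hz).mono (weightAlgebra_mono β (Set.subset_insert _ _)) le_rfl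
      · simp [weight, hadj, hJ0]
    simp only [pathSum, if_neg hyx, Finset.mul_sum]
    have hmeas : ∀ z ∈ S, Measurable fun ω =>
        G (β e₀ ω) * (J (weight (fun e => β e ω) y z) * F z ω) := fun z hz =>
      (hG.comp (hβ e₀)).mul ((hJ.comp (hwm z)).mul (hFm' z hz))
    rw [lintegral_finsetSum _ hmeas]
    refine (Finset.sum_le_sum hterm).trans ?_
    rw [← Finset.sum_filter, Finset.sum_const, nsmul_eq_mul]
    calc _ ≤ (3 ^ d : ℝ≥0∞) *
            (κ * (M * (2 * 2⁻¹ ^ l1norm ((x : Fin d → ℤ) - (y : Fin d → ℤ))))) := by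
          gcongr
          exact_mod_cast card_filter_adj_le Λ S y
      _ = (3 ^ d * κ) * 2 * (M * 2⁻¹ ^ l1norm ((x : Fin d → ℤ) - (y : Fin d → ℤ))) := by ring
      _ ≤ 2⁻¹ * 2 * (M * 2⁻¹ ^ l1norm ((x : Fin d → ℤ) - (y : Fin d → ℤ))) := by gcongr
      _ = _ := by rw [ENNReal.inv_mul_cancel (by simp) (by simp), one_mul]

end Expectation

end Lattice

lemma stepIntegral_zero : stepIntegral 0 = 0 := by
  simp [stepIntegral, stepWeight]

end SigmaModel

end

/-! ### Choice of constants and conclusion. -/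

theorem mainTheorem5 (d : ℕ) (hd : 1 ≤ d) :
    ∃ ac : ℝ, 0 < ac ∧ ∃ δ : ℝ, 0 < δ ∧ δ < 1 ∧
      ∀ a : ℝ, 0 < a → a < ac → ∃ C₀ : ℝ, 0 < C₀ ∧
        ∀ (Ω : Type*) [MeasurableSpace Ω] (P : Measure Ω) [IsProbabilityMeasure P]
          (β : SigmaModel.Edge d → Ω → ℝ),
          (∀ e, HasLaw (β e) (gammaMeasure a 1) P) → iIndepFun β P →
          ∀ η : ℝ, 0 < η →
          ∀ Λ : Finset (Fin d → ℤ), 0 ∈ Λ →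
            ((SigmaModel.lattice d).induce (Λ : Set (Fin d → ℤ))).Connected →
          ∀ (x y : Λ) (hxy : (SigmaModel.lattice d).Adj x y),
            (∫⁻ ω, SigmaModel.expMoment Λ η (fun e => β e ω) x ∂P
                ≤ ENNReal.ofReal
                    (C₀ * SigmaModel.besselI η * δ ^ SigmaModel.l1norm (x : Fin d → ℤ))) ∧
            (∫⁻ ω, ENNReal.ofReal ((β ⟨s((x : Fin d → ℤ), (y : Fin d → ℤ)), hxy⟩ ω) ^ (1 / 4 : ℝ)) *
                  SigmaModel.expMoment Λ η (fun e => β e ω) x ∂P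
                ≤ ENNReal.ofReal
                    (C₀ * SigmaModel.besselI η * δ ^ SigmaModel.l1norm (x : Fin d → ℤ))) := by
  set κ : ℝ := (3 ^ d * 2)⁻¹ with hκdef
  have hκ : 0 < κ := by positivity
  obtain ⟨ac, hac, hJ⟩ := SigmaModel.exists_lintegral_stepIntegral_le hκ
  refine ⟨ac, hac, 1 / 2, by norm_num, by norm_num, fun a ha haac => ?_⟩
  set G : ℝ → ℝ≥0∞ := fun b => ENNReal.ofReal (b ^ (1 / 4 : ℝ)) with hG
  have hGm : Measurable G := by fun_prop
  have hκ' : (3 : ℝ≥0∞) ^ d * ENNReal.ofReal κ ≤ 2⁻¹ := by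
    have e3 : (3 : ℝ≥0∞) ^ d = ENNReal.ofReal (3 ^ d) := by
      rw [ENNReal.ofReal_pow (by norm_num)]; simp
    have e2 : (2 : ℝ≥0∞)⁻¹ = ENNReal.ofReal 2⁻¹ := by
      rw [ENNReal.ofReal_inv_of_pos (by norm_num)]; simp
    rw [e3, e2, ← ENNReal.ofReal_mul (by positivity)]
    refine ENNReal.ofReal_le_ofReal (le_of_eq ?_)
    rw [hκdef]; field_simp
  have hm1 : ∫⁻ b, G b ∂gammaMeasure a 1 ≠ ⊤ := by
    rw [SigmaModel.lintegral_rpow_gammaMeasure ha (by norm_num)]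
    exact ENNReal.ofReal_ne_top
  have hm2 : ∫⁻ b, G b * SigmaModel.stepIntegral b ∂gammaMeasure a 1 ≠ ⊤ :=
    ne_top_of_le_ne_top (ENNReal.mul_ne_top ENNReal.ofReal_ne_top SigmaModel.coshConst_ne_top)
      (SigmaModel.lintegral_rpow_mul_stepIntegral_le ha (by norm_num))
  set m1 := ∫⁻ b, G b ∂gammaMeasure a 1
  set m2 := ∫⁻ b, G b * SigmaModel.stepIntegral b ∂gammaMeasure a 1
  -- The summand `1` serves the moment without weight, `m1` bounds the mean of `G`, and `κ⁻¹ * m2`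
  -- ensures that `G * stepIntegral` has mean at most `κ * C`.
  set C : ℝ := 1 + m1.toReal + κ⁻¹ * m2.toReal with hC
  have hC0 : 0 < C := by positivity
  refine ⟨C, hC0, ?_⟩
  intro Ω _ P _ β hlaw hind η hη Λ h0 _ x y hxy
  -- The weights are only almost everywhere measurable; measurable versions are used. There are
  -- countably many edges, so almost surely all weights agree with them and are nonnegative.
  set β' : SigmaModel.Edge d → Ω → ℝ := fun e => (hlaw e).aemeasurable.mk (β e) with hβ'
  have hβ'm : ∀ e, Measurable (β' e) := fun e => (hlaw e).aemeasurable.measurable_mk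
  have hae : ∀ e, β e =ᵐ[P] β' e := fun e => (hlaw e).aemeasurable.ae_eq_mk
  have hlaw' : ∀ e, HasLaw (β' e) (gammaMeasure a 1) P := fun e =>
    ⟨(hβ'm e).aemeasurable, by rw [← Measure.map_congr (hae e)]; exact (hlaw e).map_eq⟩
  have hind' : iIndepFun β' P := hind.congr hae
  have hall : ∀ᵐ ω ∂P, ∀ e, β e ω = β' e ω ∧ 0 ≤ β' e ω := by
    rw [ae_all_iff]
    intro e
    have h1 : ∀ᵐ b ∂P.map (β' e), 0 ≤ b := by
      rw [(hlaw' e).map_eq]; exact SigmaModel.ae_nonneg_gammaMeasure a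
    filter_upwards [hae e, ae_of_ae_map (hβ'm e).aemeasurable h1] with ω h2 h3
    exact ⟨h2, h3⟩
  set o : Λ := ⟨0, h0⟩ with ho
  set S : Finset Λ := Finset.univ.erase o
  set K : Ω → ℝ≥0∞ := fun ω => SigmaModel.pathSum (fun i j : Λ =>
    SigmaModel.stepIntegral (SigmaModel.weight (fun e => β' e ω) i j)) x S.card S o with hK
  have hmom : ∀ᵐ ω ∂P, SigmaModel.expMoment Λ η (fun e => β e ω) x ≤
      ENNReal.ofReal (SigmaModel.besselI η) * K ω := by
    filter_upwards [hall] with ω hω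
    have e : (fun e => β e ω) = fun e => β' e ω := funext fun e => (hω e).1
    rw [e]
    exact SigmaModel.expMoment_le_pathSum Λ hη (fun e => (hω e).2) (o := o) rfl x
  have hbI := SigmaModel.besselI_nonneg η
  set e₀ : SigmaModel.Edge d := ⟨s((x : Fin d → ℤ), (y : Fin d → ℤ)), hxy⟩ with he₀
  -- Both estimates are instances: `H = 1` and `H b = b^{1/4}`.
  have hfin : ∀ H : ℝ → ℝ≥0∞, Measurable H → ∫⁻ b, H b ∂gammaMeasure a 1 ≤ ENNReal.ofReal C →
      ∫⁻ b, H b * SigmaModel.stepIntegral b ∂gammaMeasure a 1 ≤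
        ENNReal.ofReal κ * ENNReal.ofReal C →
      ∫⁻ ω, H (β e₀ ω) * SigmaModel.expMoment Λ η (fun e => β e ω) x ∂P ≤
        ENNReal.ofReal
          (C * SigmaModel.besselI η * (1 / 2) ^ SigmaModel.l1norm (x : Fin d → ℤ)) := by
    intro H hH h1 h3
    calc _ ≤ ∫⁻ ω, ENNReal.ofReal (SigmaModel.besselI η) * (H (β' e₀ ω) * K ω) ∂P := by
          refine lintegral_mono_ae ?_
          filter_upwards [hmom, hae e₀] with ω h4 h5
          rw [h5, mul_left_comm]
          gcongr
      _ = ENNReal.ofReal (SigmaModel.besselI η) * ∫⁻ ω, H (β' e₀ ω) * K ω ∂P :=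
          lintegral_const_mul' _ _ ENNReal.ofReal_ne_top
      _ ≤ ENNReal.ofReal (SigmaModel.besselI η) *
            (ENNReal.ofReal C * 2⁻¹ ^ SigmaModel.l1norm ((x : Fin d → ℤ) - (o : Fin d → ℤ))) := by
          gcongr
          exact SigmaModel.lintegral_pathSum_le hβ'm hlaw' hind'
            SigmaModel.measurable_stepIntegral hH SigmaModel.stepIntegral_zero hκ' h1
            (hJ a ha haac) h3 x (Sym2.mem_mk_left _ _) S.card S o (Finset.notMem_erase o _)
      _ = _ := by
          have e2 : (2 : ℝ≥0∞)⁻¹ = ENNReal.ofReal (1 / 2) := by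
            rw [one_div, ENNReal.ofReal_inv_of_pos (by norm_num)]; simp
          rw [show ((x : Fin d → ℤ) - (o : Fin d → ℤ)) = x from sub_zero _, e2,
            ← ENNReal.ofReal_pow (by norm_num), ← ENNReal.ofReal_mul hC0.le,
            ← ENNReal.ofReal_mul hbI]
          congr 1; ring
  have : IsProbabilityMeasure (gammaMeasure a 1) := isProbabilityMeasure_gammaMeasure ha one_pos
  constructor
  · have hC1 : 1 ≤ ENNReal.ofReal C := by
      rw [ENNReal.one_le_ofReal, hC]
      have : 0 ≤ m1.toReal := ENNReal.toReal_nonneg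
      have : 0 ≤ κ⁻¹ * m2.toReal := by positivity
      linarith
    have h := hfin (fun _ => 1) measurable_const (by simpa using hC1) (by
      simp only [one_mul]
      calc _ ≤ ENNReal.ofReal κ * 1 := by rw [mul_one]; exact hJ a ha haac
        _ ≤ _ := by gcongr)
    simpa using h
  · refine hfin G hGm ?_ ?_
    · refine (ENNReal.le_ofReal_iff_toReal_le hm1 hC0.le).2 ?_
      have : 0 ≤ κ⁻¹ * m2.toReal := by positivity
      rw [hC]; linarith
    · rw [← ENNReal.ofReal_mul hκ.le]
      refine (ENNReal.le_ofReal_iff_toReal_le hm2 (by positivity)).2 ?_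
      have e : κ * (κ⁻¹ * m2.toReal) = m2.toReal := by field_simp
      have : 0 ≤ m1.toReal := ENNReal.toReal_nonneg
      rw [hC]
      nlinarith
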